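/- Consider the stochastic bilevel continuous knapsack problem $$\text{(SP)}\qquad \max_{b\in[b^-,b^+]}\ \mathbb{E}_{c}\bigl(d^\top x^{c}-\delta b\bigr)\quad\text{s.t.}\quad x^{c}\in\operatorname{argmax}\{c^\top x : a^\top x\le b,\ x\in[0,1]^n\},$$ where $n\ge 1$, $a\in\mathbb{N}^n$ with all $a_i>0$, $A:=\sum_{i=1}^n a_i$, $d\in\mathbb{Z}^n$, $\delta\in\mathbb{R}$ with $\delta\ge 0$, and $b^-,b^+\in\mathbb{R}$ with $0\le b^-\le b^+\le A$. Assume that the components of the random vector $c$ are independent and that $c_i$ is uniformly distributed on the interval $[c_i^-,c_i^+]$, where $c_i^-<c_i^+$ are real numbers. Then (SP) can be solved exactly in time $\mathcal{O}(n^4A)$, where each arithmetic operation on numbers, each comparison and each memory access counts as one step. That is, there are a single program of a random access machine with exact arithmetic ($+,-,\cdot,/$ and comparison on real numbers, no rounding) and a constant $C$ such that, for every input $(n,a,d,\delta,b^-,b^+,c^-,c^+)$ as above, the program halts after at most $C\,n^4A$ steps and returns an optimal capacity $b^*\in[b^-,b^+]$ together with the optimal value of (SP). The same output is correct however the follower chooses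 among several optimal packings (in particular in the optimistic and in the pessimistic setting). -/

import Mathlib

/-!
# The stochastic bilevel continuous knapsack problem, and a real random access machine
-/

namespace BilevelKnapsack

open MeasureTheory

/-! ## The problem -/

/-- An instance, with `n` items, of the stochastic bilevel continuous knapsack problem with
independent item values, the value of item `i` being uniform on `[cLo i, cHi i]`. -/
structure Instance (n : ℕ) where
  /-- item sizes -/
  a : Fin n → ℕ
  a_pos : ∀ i, 0 < a i
  /-- the leader's item values -/
  d : Fin n → ℤ
  /-- the leader's price per unit of capacity -/
  δ : ℝ
  δ_nonneg : 0 ≤ δ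
  /-- lower bound on the capacity -/
  bLo : ℝ
  /-- upper bound on the capacity -/
  bHi : ℝ
  bLo_nonneg : 0 ≤ bLo
  bLo_le_bHi : bLo ≤ bHi
  bHi_le : bHi ≤ ((∑ i, a i : ℕ) : ℝ)
  /-- left end points of the intervals of the follower's item values -/
  cLo : Fin n → ℝ
  /-- right end points of the intervals of the follower's item values -/
  cHi : Fin n → ℝ
  cLo_lt_cHi : ∀ i, cLo i < cHi i

namespace Instance

variable {n : ℕ} (I : Instance n)

/-- The total item size. -/
def A : ℕ := ∑ i, I.a i

/-- The joint distribution of the follower's item values: the product of the uniform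
distributions (normalized Lebesgue measure) on the intervals `[cLo i, cHi i]`. -/
noncomputable def law : Measure (Fin n → ℝ) :=
  Measure.pi fun i => ProbabilityTheory.cond (volume : Measure ℝ) (Set.Icc (I.cLo i) (I.cHi i))

/-- The fractional packings that respect the capacity `b`. -/
def packings (b : ℝ) : Set (Fin n → ℝ) :=
  {x | (∀ i, x i ∈ Set.Icc (0 : ℝ) 1) ∧ ∑ i, (I.a i : ℝ) * x i ≤ b}

/-- The follower's optimal packings for the capacity `b` and the item values `c`. -/
def optimalPackings (b : ℝ) (c : Fin n → ℝ) : Set (Fin n → ℝ) :=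
  {x | x ∈ I.packings b ∧ IsMaxOn (fun y : Fin n → ℝ => ∑ i, c i * y i) (I.packings b) x}

/-- `X b c` is the follower's answer to the capacity `b` under the item values `c`:
for every capacity that the leader may choose it is, almost surely, an optimal packing.
The optimistic and the pessimistic answer are two such choices. -/
def IsReaction (X : ℝ → (Fin n → ℝ) → (Fin n → ℝ)) : Prop :=
  ∀ b ∈ Set.Icc I.bLo I.bHi, ∀ᵐ c ∂I.law, X b c ∈ I.optimalPackings b c

/-- The leader's payoff for the capacity `b` and the packing `x`. -/
noncomputable def payoff (b : ℝ) (x : Fin n → ℝ) : ℝ :=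
  ∑ i, (I.d i : ℝ) * x i - I.δ * b

/-- The leader's expected payoff for the capacity `b` when the follower answers with `X`. -/
noncomputable def expectedPayoff (X : ℝ → (Fin n → ℝ) → (Fin n → ℝ)) (b : ℝ) : ℝ :=
  ∫ c, I.payoff b (X b c) ∂I.law

/-- `b` is an optimal capacity for the leader and `v` is the optimal value, whichever way the
follower breaks ties; the expectations involved exist, and so do answers of the follower. -/
def IsSolution (b v : ℝ) : Prop :=
  b ∈ Set.Icc I.bLo I.bHi ∧
  (∃ X, I.IsReaction X) ∧
  ∀ X, I.IsReaction X →
    (∀ b' ∈ Set.Icc I.bLo I.bHi, Integrable (fun c => I.payoff b' (X b' c)) I.law) ∧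
    IsMaxOn (I.expectedPayoff X) (Set.Icc I.bLo I.bHi) b ∧
    I.expectedPayoff X b = v

end Instance

/-! ## The machine

A real random access machine: finitely many (those named in the program) index variables and
real variables, and finitely many unbounded arrays of natural numbers and of real numbers, whose
cells are addressed by computed natural numbers.  Every operation on a number, every memory access
and every test takes one step.  There is no rounding from real to natural numbers, and the only
constants are natural numbers. -/

/-- The memory contents. -/
structure State where
  /-- index variables -/
  ivar : ℕ → ℕ
  /-- real variables -/
  rvar : ℕ → ℝ
  /-- index arrays: name of the array, then position -/
  iarr : ℕ → ℕ → ℕ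
  /-- real arrays: name of the array, then position -/
  rarr : ℕ → ℕ → ℝ

/-- Expressions with values in the natural numbers; `sub` is truncated at `0`. -/
inductive IExp where
  | const (k : ℕ)
  | var (x : ℕ)
  | get (m : ℕ) (pos : IExp)
  | add (e f : IExp)
  | sub (e f : IExp)
  | mul (e f : IExp)

/-- The value of an index expression. -/
def IExp.eval (s : State) : IExp → ℕ
  | const k => k
  | var x => s.ivar x
  | get m pos => s.iarr m (pos.eval s)
  | add e f => e.eval s + f.eval s
  | sub e f => e.eval s - f.eval s
  | mul e f => e.eval s * f.eval s

/-- The number of steps for evaluating an index expression. -/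
def IExp.cost : IExp → ℕ
  | const _ => 1
  | var _ => 1
  | get _ pos => pos.cost + 1
  | add e f => e.cost + f.cost + 1
  | sub e f => e.cost + f.cost + 1
  | mul e f => e.cost + f.cost + 1

/-- Expressions with real values; `div` returns `0` if the divisor is `0`. -/
inductive RExp where
  | ofIndex (e : IExp)
  | var (x : ℕ)
  | get (m : ℕ) (pos : IExp)
  | add (e f : RExp)
  | sub (e f : RExp)
  | mul (e f : RExp)
  | div (e f : RExp)

/-- The value of a real expression. -/
noncomputable def RExp.eval (s : State) : RExp → ℝ
  | ofIndex e => (e.eval s : ℝ)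
  | var x => s.rvar x
  | get m pos => s.rarr m (pos.eval s)
  | add e f => e.eval s + f.eval s
  | sub e f => e.eval s - f.eval s
  | mul e f => e.eval s * f.eval s
  | div e f => e.eval s / f.eval s

/-- The number of steps for evaluating a real expression. -/
def RExp.cost : RExp → ℕ
  | ofIndex e => e.cost + 1
  | var _ => 1
  | get _ pos => pos.cost + 1
  | add e f => e.cost + f.cost + 1
  | sub e f => e.cost + f.cost + 1
  | mul e f => e.cost + f.cost + 1
  | div e f => e.cost + f.cost + 1

/-- Tests. -/
inductive Test where
  | ile (e f : IExp)
  | rle (e f : RExp)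
  | neg (t : Test)

/-- The test `t` succeeds in the state `s`. -/
def Test.Holds (s : State) : Test → Prop
  | ile e f => e.eval s ≤ f.eval s
  | rle e f => e.eval s ≤ f.eval s
  | neg t => ¬ t.Holds s

/-- The number of steps for a test. -/
def Test.cost : Test → ℕ
  | ile e f => e.cost + f.cost + 1
  | rle e f => e.cost + f.cost + 1
  | neg t => t.cost + 1

/-- Programs; `ite` branches on a test and `loop t p` repeats `p` as long as `t` succeeds. -/
inductive Program where
  | skip
  | isetVar (x : ℕ) (e : IExp)
  | rsetVar (x : ℕ) (e : RExp)
  | isetArr (m : ℕ) (pos e : IExp)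
  | rsetArr (m : ℕ) (pos : IExp) (e : RExp)
  | seq (p q : Program)
  | ite (t : Test) (p q : Program)
  | loop (t : Test) (p : Program)

/-- `Exec p s s' k`: started in the state `s`, the program `p` halts in the state `s'` after
exactly `k` steps. -/
inductive Exec : Program → State → State → ℕ → Prop where
  | skip (s : State) : Exec .skip s s 1
  | isetVar (s : State) (x : ℕ) (e : IExp) :
      Exec (.isetVar x e) s { s with ivar := Function.update s.ivar x (e.eval s) } (e.cost + 1)
  | rsetVar (s : State) (x : ℕ) (e : RExp) :
      Exec (.rsetVar x e) s { s with rvar := Function.update s.rvar x (e.eval s) } (e.cost + 1)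
  | isetArr (s : State) (m : ℕ) (pos e : IExp) :
      Exec (.isetArr m pos e) s
        { s with iarr := Function.update s.iarr m
                         (Function.update (s.iarr m) (pos.eval s) (e.eval s)) }
        (pos.cost + e.cost + 1)
  | rsetArr (s : State) (m : ℕ) (pos : IExp) (e : RExp) :
      Exec (.rsetArr m pos e) s
        { s with rarr := Function.update s.rarr m
                         (Function.update (s.rarr m) (pos.eval s) (e.eval s)) }
        (pos.cost + e.cost + 1)
  | seq {p q : Program} {s s' s'' : State} {k l : ℕ} :
      Exec p s s' k → Exec q s' s'' l → Exec (.seq p q) s s'' (k + l)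
  | ite_true {t : Test} {p q : Program} {s s' : State} {k : ℕ} :
      t.Holds s → Exec p s s' k → Exec (.ite t p q) s s' (t.cost + k)
  | ite_false {t : Test} {p q : Program} {s s' : State} {k : ℕ} :
      ¬ t.Holds s → Exec q s s' k → Exec (.ite t p q) s s' (t.cost + k)
  | loop_true {t : Test} {p : Program} {s s' s'' : State} {k l : ℕ} :
      t.Holds s → Exec p s s' k → Exec (.loop t p) s' s'' l →
        Exec (.loop t p) s s'' (t.cost + k + l)
  | loop_false {t : Test} {p : Program} {s : State} :
      ¬ t.Holds s → Exec (.loop t p) s s t.cost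

/-! ## Input -/

/-- The array that starts with the given `n` entries and is `0` afterwards. -/
def toArray {α : Type} [Zero α] {n : ℕ} (v : Fin n → α) (k : ℕ) : α :=
  if h : k < n then v ⟨k, h⟩ else 0

/-- The initial memory for an instance: the index variable `0` holds `n`, the real variables
`0`, `1`, `2` hold `δ` and the two capacity bounds, the index array `0` holds the item sizes and
the real arrays `0`, `1`, `2` hold the left end points, the right end points and the leader's
item values; everything else is `0`. -/
noncomputable def Instance.input {n : ℕ} (I : Instance n) : State where
  ivar x := if x = 0 then n else 0
  rvar x := if x = 0 then I.δ else if x = 1 then I.bLo else if x = 2 then I.bHi else 0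
  iarr x := if x = 0 then toArray I.a else 0
  rarr x := if x = 0 then toArray I.cLo else if x = 1 then toArray I.cHi
    else if x = 2 then toArray (fun i => (I.d i : ℝ)) else 0

end BilevelKnapsack

namespace BilevelKnapsack

/-! ## A total-correctness calculus with costs -/

/-! Almost surely no item value is zero and no two items tie in efficiency. An exchange argument
then forces every optimal packing of the follower to be the greedy one
(`Instance.optimal_eq_share`), so tie-breaking is irrelevant and the leader maximizes the
deterministic function `Instance.value`.

Condition on the value t > 0 of an item i. The other items precede it independently, with
probabilities given by `tail`, so its expected share is the mean of `fill` at a random integer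
weight, and `Instance.integral_share` integrates this over t. The values at which i becomes as
efficient as some item with value at an interval end point cut the range of t into at most 2n
pieces, on each of which all these probabilities p_j are affine. There the product of the factors
p_j z^(a_j) + 1 - p_j is the generating function of the weight ahead of i, a polynomial in z and the
offset u of t. Its degree in u is at most n, so the substitution u = X, z = X^(n+1) loses no
information (`weightedIntegral_prod`). The result fits in one array of length O(nA), multiplication
by a factor is a four-term recurrence (`shiftedCoeff_mul_factor`), and integration is termwise.

As a function of the capacity, a_i times the share after weight w is a difference of two hinges at
integers (`max_sub_max_eq_mul_fill`). Hence the objective is piecewise linear with integer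
breakpoints; its slope changes are collected in an array, and one sweep over the unit intervals
finds the maximum (`WP.extend`).

There are n items, at most 2n pieces per item, n factors per piece and O(nA) coefficients per
factor, whence n^4 A. Correctness and cost are proved together, in the calculus of `WP`. -/

/-- The registers and arrays that the program uses, by name. -/
structure Mem where
  n : ℕ
  A : ℕ
  i : ℕ
  j : ℕ
  w : ℕ
  e : ℕ
  y : ℕ
  δ : ℝ
  bLo : ℝ
  bHi : ℝ
  t : ℝ
  u : ℝ
  p : ℝ
  r : ℝ
  q : ℝ
  z : ℝ
  val : ℝ
  slope : ℝ
  best : ℝ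
  arg : ℝ
  cand : ℝ
  a : ℕ → ℕ
  lo : ℕ → ℝ
  hi : ℕ → ℝ
  d : ℕ → ℝ
  G : ℕ → ℝ
  D : ℕ → ℝ

/-- The machine state with the given registers and arrays; the rest of the memory is `0`. -/
def Mem.state (m : Mem) : State where
  ivar
    | 0 => m.n | 1 => m.A | 2 => m.i | 3 => m.j | 4 => m.w | 5 => m.e | 6 => m.y | _ => 0
  rvar
    | 0 => m.δ | 1 => m.bLo | 2 => m.bHi | 3 => m.t | 4 => m.u | 5 => m.p | 6 => m.r
    | 7 => m.q | 8 => m.z | 9 => m.val | 10 => m.slope | 11 => m.best | 12 => m.arg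
    | 13 => m.cand | _ => 0
  iarr
    | 0 => m.a | _ => 0
  rarr
    | 0 => m.lo | 1 => m.hi | 2 => m.d | 3 => m.G | 4 => m.D | _ => 0

/-- Started in `m`, the program `p` halts after at most `K` steps with a memory satisfying `Q`. -/
def WP (p : Program) (K : ℕ) (Q : Mem → Prop) (m : Mem) : Prop :=
  ∃ m' k, Exec p m.state m'.state k ∧ k ≤ K ∧ Q m'

namespace WP

variable {p q : Program} {K K₁ K₂ : ℕ} {Q R : Mem → Prop} {m : Mem}

theorem mono (h : WP p K₁ R m) (hK : K₁ ≤ K) (hQ : ∀ m', R m' → Q m') : WP p K Q m := by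
  obtain ⟨m', k, he, hk, hm⟩ := h
  exact ⟨m', k, he, hk.trans hK, hQ _ hm⟩

theorem le (h : WP p K₁ Q m) (hK : K₁ ≤ K) : WP p K Q m := h.mono hK fun _ => id

theorem skip (h : Q m) : WP .skip 1 Q m := ⟨m, 1, .skip _, le_rfl, h⟩

theorem seq (h : WP p K₁ R m) (h' : ∀ m', R m' → WP q K₂ Q m') :
    WP (.seq p q) (K₁ + K₂) Q m := by
  obtain ⟨m₁, k₁, e₁, hk₁, hm⟩ := h
  obtain ⟨m₂, k₂, e₂, hk₂, hm₂⟩ := h' _ hm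
  exact ⟨m₂, k₁ + k₂, .seq e₁ e₂, by omega, hm₂⟩

theorem ite {t : Test} (h : t.Holds m.state → WP p K Q m)
    (h' : ¬ t.Holds m.state → WP q K Q m) : WP (.ite t p q) (t.cost + K) Q m := by
  by_cases ht : t.Holds m.state
  · obtain ⟨m', k, e, hk, hm⟩ := h ht
    exact ⟨m', _, .ite_true ht e, by omega, hm⟩
  · obtain ⟨m', k, e, hk, hm⟩ := h' ht
    exact ⟨m', _, .ite_false ht e, by omega, hm⟩

/-- The measure drops in every round, so there are at most `M` rounds; the extra `t.cost` pays for
the final failing test. -/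
theorem loop {t : Test} (Inv : Mem → Prop) (μ : Mem → ℕ)
    (hbody : ∀ m, Inv m → t.Holds m.state → WP p K (fun m' => Inv m' ∧ μ m' < μ m) m)
    (hm : Inv m) (hQ : ∀ m', Inv m' → ¬ t.Holds m'.state → Q m') {M : ℕ} (hM : μ m ≤ M) :
    WP (.loop t p) (M * (K + t.cost) + t.cost) Q m := by
  induction M generalizing m with
  | zero =>
    by_cases ht : t.Holds m.state
    · obtain ⟨m', k, e, hk, -, h2⟩ := hbody m hm ht
      omega
    · exact ⟨m, _, .loop_false ht, by omega, hQ _ hm ht⟩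
  | succ M ih =>
    by_cases ht : t.Holds m.state
    · obtain ⟨m', k, e, hk, h1, h2⟩ := hbody m hm ht
      obtain ⟨m'', l, e', hl, h3⟩ := ih h1 (by omega)
      refine ⟨m'', _, .loop_true ht e e', ?_, h3⟩
      rw [Nat.succ_mul]
      omega
    · exact ⟨m, _, .loop_false ht, by omega, hQ _ hm ht⟩

theorem isetVar {x : ℕ} {e : IExp} (m' : Mem)
    (h : m'.state = { m.state with ivar := Function.update m.state.ivar x (e.eval m.state) })
    (hQ : Q m') : WP (.isetVar x e) (e.cost + 1) Q m :=
  ⟨m', _, h ▸ .isetVar _ _ _, le_rfl, hQ⟩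

theorem rsetVar {x : ℕ} {e : RExp} (m' : Mem)
    (h : m'.state = { m.state with rvar := Function.update m.state.rvar x (e.eval m.state) })
    (hQ : Q m') : WP (.rsetVar x e) (e.cost + 1) Q m :=
  ⟨m', _, h ▸ .rsetVar _ _ _, le_rfl, hQ⟩

theorem rsetArr {x : ℕ} {pos : IExp} {e : RExp} (m' : Mem)
    (h : m'.state = { m.state with
      rarr := Function.update m.state.rarr x
        (Function.update (m.state.rarr x) (pos.eval m.state) (e.eval m.state)) })
    (hQ : Q m') : WP (.rsetArr x pos e) (pos.cost + e.cost + 1) Q m :=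
  ⟨m', _, h ▸ .rsetArr _ _ _ _, le_rfl, hQ⟩

/-- One assignment rule per register: a case split on the register number identifies the updated
function with the updated record. The rules for the other registers and the two arrays follow the
same pattern. -/
theorem setA {e : IExp} (h : Q { m with A := e.eval m.state }) :
    WP (.isetVar 1 e) (e.cost + 1) Q m :=
  isetVar { m with A := e.eval m.state }
    (congrArg (State.mk · _ _ _) <| funext fun k => by
    rcases k with _ | _ | _ | _ | _ | _ | _ | k <;> rfl) h

theorem setI {e : IExp} (h : Q { m with i := e.eval m.state }) :
    WP (.isetVar 2 e) (e.cost + 1) Q m :=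
  isetVar { m with i := e.eval m.state }
    (congrArg (State.mk · _ _ _) <| funext fun k => by
    rcases k with _ | _ | _ | _ | _ | _ | _ | k <;> rfl) h

theorem setJ {e : IExp} (h : Q { m with j := e.eval m.state }) :
    WP (.isetVar 3 e) (e.cost + 1) Q m :=
  isetVar { m with j := e.eval m.state }
    (congrArg (State.mk · _ _ _) <| funext fun k => by
    rcases k with _ | _ | _ | _ | _ | _ | _ | k <;> rfl) h

theorem setW {e : IExp} (h : Q { m with w := e.eval m.state }) :
    WP (.isetVar 4 e) (e.cost + 1) Q m :=
  isetVar { m with w := e.eval m.state }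
    (congrArg (State.mk · _ _ _) <| funext fun k => by
    rcases k with _ | _ | _ | _ | _ | _ | _ | k <;> rfl) h

theorem setE {e : IExp} (h : Q { m with e := e.eval m.state }) :
    WP (.isetVar 5 e) (e.cost + 1) Q m :=
  isetVar { m with e := e.eval m.state }
    (congrArg (State.mk · _ _ _) <| funext fun k => by
    rcases k with _ | _ | _ | _ | _ | _ | _ | k <;> rfl) h

theorem setY {e : IExp} (h : Q { m with y := e.eval m.state }) :
    WP (.isetVar 6 e) (e.cost + 1) Q m :=
  isetVar { m with y := e.eval m.state }
    (congrArg (State.mk · _ _ _) <| funext fun k => by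
    rcases k with _ | _ | _ | _ | _ | _ | _ | k <;> rfl) h

theorem setDelta {e : RExp} (h : Q { m with δ := e.eval m.state }) :
    WP (.rsetVar 0 e) (e.cost + 1) Q m :=
  rsetVar { m with δ := e.eval m.state }
    (congrArg (State.mk _ · _ _) <| funext fun k => by
    rcases k with _ | _ | _ | _ | _ | _ | _ | _ | _ | _ | _ | _ | _ | _ | k <;> rfl) h

theorem setBLo {e : RExp} (h : Q { m with bLo := e.eval m.state }) :
    WP (.rsetVar 1 e) (e.cost + 1) Q m :=
  rsetVar { m with bLo := e.eval m.state }
    (congrArg (State.mk _ · _ _) <| funext fun k => by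
    rcases k with _ | _ | _ | _ | _ | _ | _ | _ | _ | _ | _ | _ | _ | _ | k <;> rfl) h

theorem setTReal {e : RExp} (h : Q { m with t := e.eval m.state }) :
    WP (.rsetVar 3 e) (e.cost + 1) Q m :=
  rsetVar { m with t := e.eval m.state }
    (congrArg (State.mk _ · _ _) <| funext fun k => by
    rcases k with _ | _ | _ | _ | _ | _ | _ | _ | _ | _ | _ | _ | _ | _ | k <;> rfl) h

theorem setUReal {e : RExp} (h : Q { m with u := e.eval m.state }) :
    WP (.rsetVar 4 e) (e.cost + 1) Q m :=
  rsetVar { m with u := e.eval m.state }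
    (congrArg (State.mk _ · _ _) <| funext fun k => by
    rcases k with _ | _ | _ | _ | _ | _ | _ | _ | _ | _ | _ | _ | _ | _ | k <;> rfl) h

theorem setPReal {e : RExp} (h : Q { m with p := e.eval m.state }) :
    WP (.rsetVar 5 e) (e.cost + 1) Q m :=
  rsetVar { m with p := e.eval m.state }
    (congrArg (State.mk _ · _ _) <| funext fun k => by
    rcases k with _ | _ | _ | _ | _ | _ | _ | _ | _ | _ | _ | _ | _ | _ | k <;> rfl) h

theorem setRReal {e : RExp} (h : Q { m with r := e.eval m.state }) :
    WP (.rsetVar 6 e) (e.cost + 1) Q m :=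
  rsetVar { m with r := e.eval m.state }
    (congrArg (State.mk _ · _ _) <| funext fun k => by
    rcases k with _ | _ | _ | _ | _ | _ | _ | _ | _ | _ | _ | _ | _ | _ | k <;> rfl) h

theorem setQReal {e : RExp} (h : Q { m with q := e.eval m.state }) :
    WP (.rsetVar 7 e) (e.cost + 1) Q m :=
  rsetVar { m with q := e.eval m.state }
    (congrArg (State.mk _ · _ _) <| funext fun k => by
    rcases k with _ | _ | _ | _ | _ | _ | _ | _ | _ | _ | _ | _ | _ | _ | k <;> rfl) h

theorem setZReal {e : RExp} (h : Q { m with z := e.eval m.state }) :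
    WP (.rsetVar 8 e) (e.cost + 1) Q m :=
  rsetVar { m with z := e.eval m.state }
    (congrArg (State.mk _ · _ _) <| funext fun k => by
    rcases k with _ | _ | _ | _ | _ | _ | _ | _ | _ | _ | _ | _ | _ | _ | k <;> rfl) h

theorem setVal {e : RExp} (h : Q { m with val := e.eval m.state }) :
    WP (.rsetVar 9 e) (e.cost + 1) Q m :=
  rsetVar { m with val := e.eval m.state }
    (congrArg (State.mk _ · _ _) <| funext fun k => by
    rcases k with _ | _ | _ | _ | _ | _ | _ | _ | _ | _ | _ | _ | _ | _ | k <;> rfl) h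

theorem setSlope {e : RExp} (h : Q { m with slope := e.eval m.state }) :
    WP (.rsetVar 10 e) (e.cost + 1) Q m :=
  rsetVar { m with slope := e.eval m.state }
    (congrArg (State.mk _ · _ _) <| funext fun k => by
    rcases k with _ | _ | _ | _ | _ | _ | _ | _ | _ | _ | _ | _ | _ | _ | k <;> rfl) h

theorem setBest {e : RExp} (h : Q { m with best := e.eval m.state }) :
    WP (.rsetVar 11 e) (e.cost + 1) Q m :=
  rsetVar { m with best := e.eval m.state }
    (congrArg (State.mk _ · _ _) <| funext fun k => by
    rcases k with _ | _ | _ | _ | _ | _ | _ | _ | _ | _ | _ | _ | _ | _ | k <;> rfl) h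

theorem setArg {e : RExp} (h : Q { m with arg := e.eval m.state }) :
    WP (.rsetVar 12 e) (e.cost + 1) Q m :=
  rsetVar { m with arg := e.eval m.state }
    (congrArg (State.mk _ · _ _) <| funext fun k => by
    rcases k with _ | _ | _ | _ | _ | _ | _ | _ | _ | _ | _ | _ | _ | _ | k <;> rfl) h

theorem setCand {e : RExp} (h : Q { m with cand := e.eval m.state }) :
    WP (.rsetVar 13 e) (e.cost + 1) Q m :=
  rsetVar { m with cand := e.eval m.state }
    (congrArg (State.mk _ · _ _) <| funext fun k => by
    rcases k with _ | _ | _ | _ | _ | _ | _ | _ | _ | _ | _ | _ | _ | _ | k <;> rfl) h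

theorem storeG {pos : IExp} {e : RExp}
    (h : Q { m with G := Function.update m.G (pos.eval m.state) (e.eval m.state) }) :
    WP (.rsetArr 3 pos e) (pos.cost + e.cost + 1) Q m :=
  rsetArr { m with G := Function.update m.G (pos.eval m.state) (e.eval m.state) }
    (congrArg (State.mk _ _ _ ·) <| funext fun k => by
    rcases k with _ | _ | _ | _ | _ | k <;> rfl) h

theorem storeD {pos : IExp} {e : RExp}
    (h : Q { m with D := Function.update m.D (pos.eval m.state) (e.eval m.state) }) :
    WP (.rsetArr 4 pos e) (pos.cost + e.cost + 1) Q m :=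
  rsetArr { m with D := Function.update m.D (pos.eval m.state) (e.eval m.state) }
    (congrArg (State.mk _ _ _ ·) <| funext fun k => by
    rcases k with _ | _ | _ | _ | _ | k <;> rfl) h

end WP

open MeasureTheory

/-! ## The follower's answer -/

/-- The fraction of an item of size `a` that fits into a knapsack of capacity `b` in which
items of total size `w` have been packed. -/
noncomputable def fill (b : ℝ) (a w : ℕ) : ℝ := max 0 (min 1 ((b - w) / a))

theorem fill_nonneg (b : ℝ) (a w : ℕ) : 0 ≤ fill b a w := le_max_left _ _

theorem fill_le_one (b : ℝ) (a w : ℕ) : fill b a w ≤ 1 :=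
  max_le zero_le_one (min_le_left _ _)

namespace Instance

variable {n : ℕ} (I : Instance n)

/-- The total size of the items that are more efficient than item `i`. -/
noncomputable def ahead (c : Fin n → ℝ) (i : Fin n) : ℕ :=
  ∑ j, if c i * I.a j < c j * I.a i then I.a j else 0

/-- The fraction of item `i` in the greedy packing. -/
noncomputable def share (b : ℝ) (c : Fin n → ℝ) (i : Fin n) : ℝ :=
  if 0 < c i then fill b (I.a i) (I.ahead c i) else 0

variable {I} {b : ℝ} {c x : Fin n → ℝ}

/-- Moving one coordinate within the feasible set cannot increase the follower's objective. -/
theorem optimal_perturb_one (hx : x ∈ I.optimalPackings b c) {i : Fin n} {s : ℝ}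
    (hs : x i + s ∈ Set.Icc (0 : ℝ) 1) (hb : ∑ k, (I.a k : ℝ) * x k + I.a i * s ≤ b) :
    c i * s ≤ 0 := by
  have hsum : ∀ g : Fin n → ℝ, ∑ k, g k * (x k + if k = i then s else 0)
      = ∑ k, g k * x k + g i * s := by
    intro g
    simp [mul_add, Finset.sum_add_distrib]
  have hy : (fun k => x k + if k = i then s else 0) ∈ I.packings b := by
    refine ⟨fun k => ?_, ?_⟩
    · dsimp only
      split_ifs with h
      · exact h ▸ hs
      · simpa using hx.1.1 k
    · rw [hsum]; exact hb
  have := hx.2 hy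
  simp only [Set.mem_ofPred_eq, hsum] at this
  linarith

theorem optimal_perturb_two (hx : x ∈ I.optimalPackings b c) {i j : Fin n} (hij : i ≠ j) {s r : ℝ}
    (hs : x i + s ∈ Set.Icc (0 : ℝ) 1) (hr : x j + r ∈ Set.Icc (0 : ℝ) 1)
    (hb : ∑ k, (I.a k : ℝ) * x k + I.a i * s + I.a j * r ≤ b) :
    c i * s + c j * r ≤ 0 := by
  have hsum : ∀ g : Fin n → ℝ,
      ∑ k, g k * (x k + (if k = i then s else 0) + if k = j then r else 0)
      = ∑ k, g k * x k + g i * s + g j * r := by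
    intro g
    simp [mul_add, Finset.sum_add_distrib]
  have hy : (fun k => x k + (if k = i then s else 0) + if k = j then r else 0)
      ∈ I.packings b := by
    refine ⟨fun k => ?_, ?_⟩
    · dsimp only
      by_cases h : k = i
      · subst h; simpa [hij] using hs
      · by_cases h' : k = j
        · subst h'; simpa [h] using hr
        · simpa [h, h'] using hx.1.1 k
    · rw [hsum]; exact hb
  have := hx.2 hy
  simp only [Set.mem_ofPred_eq, hsum] at this
  linarith

theorem optimal_eq_zero_of_neg (hx : x ∈ I.optimalPackings b c) {i : Fin n} (hc : c i < 0) :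
    x i = 0 := by
  have h0 := (hx.1.1 i).1
  have ha : (0 : ℝ) ≤ I.a i := Nat.cast_nonneg _
  have := optimal_perturb_one hx (i := i) (s := -x i) (by simp) (by nlinarith [hx.1.2])
  nlinarith

theorem optimal_full_of_pos (hx : x ∈ I.optimalPackings b c) {i : Fin n} (hc : 0 < c i)
    (hi : x i < 1) : ∑ k, (I.a k : ℝ) * x k = b := by
  refine le_antisymm hx.1.2 (not_lt.1 fun hlt => ?_)
  have ha : (0 : ℝ) < I.a i := Nat.cast_pos.2 (I.a_pos i)
  have h0 := (hx.1.1 i).1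
  -- The largest increase of item i allowed by its upper bound and by the unused capacity.
  obtain ⟨s, hs⟩ : ∃ s, s = min (1 - x i) ((b - ∑ k, (I.a k : ℝ) * x k) / I.a i) := ⟨_, rfl⟩
  have hs0 : 0 < s := by
    rw [hs]
    exact lt_min (by linarith) (div_pos (by linarith) ha)
  have h1 : s ≤ 1 - x i := hs ▸ min_le_left _ _
  have h2 : s * I.a i ≤ b - ∑ k, (I.a k : ℝ) * x k :=
    (le_div_iff₀ ha).1 (hs ▸ min_le_right _ _)
  have := optimal_perturb_one hx (i := i) (s := s) ⟨by linarith, by linarith⟩ (by linarith)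
  nlinarith

/-- Trading `s * a i` of item j for `s * a j` of item i leaves the used capacity unchanged and gains
`s * (c i * a j - c j * a i)`, which is positive. -/
theorem optimal_exchange (hx : x ∈ I.optimalPackings b c) {i j : Fin n}
    (hc : c j * I.a i < c i * I.a j) (hi : x i < 1) : x j = 0 := by
  have hij : i ≠ j := by
    rintro rfl
    exact lt_irrefl _ hc
  by_contra hj
  have hai : (0 : ℝ) < I.a i := Nat.cast_pos.2 (I.a_pos i)
  have haj : (0 : ℝ) < I.a j := Nat.cast_pos.2 (I.a_pos j)
  have hj0 : 0 < x j := lt_of_le_of_ne (hx.1.1 j).1 (Ne.symm hj)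
  have hj1 := (hx.1.1 j).2
  have hi0 := (hx.1.1 i).1
  obtain ⟨s, hs⟩ : ∃ s, s = min ((1 - x i) / I.a j) (x j / I.a i) := ⟨_, rfl⟩
  have hs0 : 0 < s := by
    rw [hs]
    exact lt_min (div_pos (by linarith) haj) (div_pos hj0 hai)
  have h1 : s * I.a j ≤ 1 - x i := (le_div_iff₀ haj).1 (hs ▸ min_le_left _ _)
  have h2 : s * I.a i ≤ x j := (le_div_iff₀ hai).1 (hs ▸ min_le_right _ _)
  have h3 : 0 ≤ s * I.a j := by positivity
  have h4 : 0 ≤ s * I.a i := by positivity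
  have := optimal_perturb_two hx hij (s := s * I.a j) (r := -(s * I.a i))
    ⟨by linarith, by linarith⟩ ⟨by linarith, by linarith⟩ (by linarith [hx.1.2])
  nlinarith

theorem optimal_eq_share (hx : x ∈ I.optimalPackings b c) (h0 : ∀ i, c i ≠ 0)
    (hne : ∀ i j, i ≠ j → c i * I.a j ≠ c j * I.a i) (i : Fin n) : x i = I.share b c i := by
  unfold share
  split_ifs with hc
  swap
  · exact optimal_eq_zero_of_neg hx (lt_of_le_of_ne (not_lt.1 hc) (h0 i))
  have ha : (0 : ℝ) < I.a i := Nat.cast_pos.2 (I.a_pos i)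
  have hx0 := (hx.1.1 i).1
  have hx1 := (hx.1.1 i).2
  -- Written as one sum over all items, this quantity can be compared termwise with the used
  -- capacity.
  have hW : ((I.ahead c i : ℕ) : ℝ) + I.a i * x i
      = ∑ j, ((if c i * I.a j < c j * I.a i then (I.a j : ℝ) else 0)
          + if j = i then I.a i * x i else 0) := by
    rw [Finset.sum_add_distrib]
    simp [ahead]
  -- If item i is packed at all, every more efficient item is packed completely.
  have hlow : 0 < x i → x i ≤ (b - I.ahead c i) / I.a i := by
    intro hi
    rw [le_div_iff₀ ha]
    suffices ((I.ahead c i : ℕ) : ℝ) + I.a i * x i ≤ ∑ k, (I.a k : ℝ) * x k by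
      linarith [hx.1.2]
    rw [hW]
    refine Finset.sum_le_sum fun j _ => ?_
    by_cases hji : j = i
    · subst hji; simp
    · have hj0 := (hx.1.1 j).1
      split_ifs with h
      · have : x j = 1 := by
          by_contra hj
          exact hi.ne' (optimal_exchange hx h (lt_of_le_of_ne (hx.1.1 j).2 hj))
        simp [this]
      · have : (0 : ℝ) ≤ I.a j := Nat.cast_nonneg _
        simp only [add_zero]
        positivity
  -- If item i is not complete, no less efficient item is packed and the capacity is exhausted.
  have hup : x i < 1 → (b - I.ahead c i) / I.a i ≤ x i := by
    intro hi
    rw [div_le_iff₀ ha]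
    suffices ∑ k, (I.a k : ℝ) * x k ≤ ((I.ahead c i : ℕ) : ℝ) + I.a i * x i by
      rw [optimal_full_of_pos hx hc hi] at this
      linarith
    rw [hW]
    refine Finset.sum_le_sum fun j _ => ?_
    by_cases hji : j = i
    · subst hji; simp
    · have : (0 : ℝ) ≤ I.a j := Nat.cast_nonneg _
      rw [if_neg hji]
      split_ifs with h
      · nlinarith [(hx.1.1 j).2]
      · rw [optimal_exchange hx (lt_of_le_of_ne (not_lt.1 h) (hne j i hji)) hi]
        simp
  unfold fill
  -- At `x i = 0` only the upper estimate is available, at `x i = 1` only the lower one; the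
  -- truncation in `fill` absorbs the missing one.
  rcases hx0.eq_or_lt with h | h
  · have := hup (by linarith)
    rw [← h] at this ⊢
    exact (max_eq_left ((min_le_right _ _).trans this)).symm
  · rcases hx1.eq_or_lt with h' | h'
    · have := hlow h
      rw [h'] at this ⊢
      rw [min_eq_left this]
      simp
    · rw [← le_antisymm (hlow h) (hup h'), min_eq_right hx1, max_eq_right hx0]

theorem optimalPackings_nonempty (I : Instance n) (hb : 0 ≤ b) (c : Fin n → ℝ) :
    (I.optimalPackings b c).Nonempty := by
  have hcomp : IsCompact (I.packings b) := by
    have : I.packings b = (Set.univ.pi fun _ : Fin n => Set.Icc (0 : ℝ) 1) ∩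
        {x | ∑ i, (I.a i : ℝ) * x i ≤ b} := by
      ext x
      simp only [packings, Set.mem_inter_iff, Set.mem_univ_pi, Set.mem_ofPred_eq]
    rw [this]
    exact (isCompact_univ_pi fun _ => isCompact_Icc).inter_right
      (isClosed_le (by fun_prop) continuous_const)
  obtain ⟨x, hx, hmax⟩ := hcomp.exists_isMaxOn ⟨0, by simp [packings, hb]⟩
    (f := fun y : Fin n → ℝ => ∑ i, c i * y i) (by fun_prop)
  exact ⟨x, hx, hmax⟩

/-- A pointwise choice is enough: a reaction need not be measurable, since integrability of the
payoff comes from its almost sure agreement with the greedy payoff. -/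
theorem exists_isReaction (I : Instance n) : ∃ X, I.IsReaction X := by
  classical
  refine ⟨fun b c => if h : 0 ≤ b then (I.optimalPackings_nonempty h c).choose else 0,
    fun b hb => .of_forall fun c => ?_⟩
  have h : 0 ≤ b := I.bLo_nonneg.trans hb.1
  simp only [h, dif_pos]
  exact (I.optimalPackings_nonempty h c).choose_spec

end Instance

/-! ## Expectations -/

/-- The distribution of one item value. -/
noncomputable abbrev Instance.valueLaw {n : ℕ} (I : Instance n) (i : Fin n) : Measure ℝ :=
  ProbabilityTheory.cond (volume : Measure ℝ) (Set.Icc (I.cLo i) (I.cHi i))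

instance {n : ℕ} (I : Instance n) (i : Fin n) : IsProbabilityMeasure (I.valueLaw i) :=
  ProbabilityTheory.cond_isProbabilityMeasure_of_finite
    (by simp [I.cLo_lt_cHi i]) (by simp)

instance {n : ℕ} (I : Instance n) : IsProbabilityMeasure I.law :=
  inferInstanceAs (IsProbabilityMeasure (Measure.pi I.valueLaw))

instance {n : ℕ} (I : Instance n) (i : Fin n) : NullSingletonClass (I.valueLaw i) := by
  refine ⟨fun t => ?_⟩
  rw [ProbabilityTheory.cond_apply measurableSet_Icc,
    measure_mono_null Set.inter_subset_right (measure_singleton t), mul_zero]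

/-! ### Independence: resampling a coordinate, and functions of random subset sums. -/

/-- Resampling one coordinate does not change a product of probability measures. -/
theorem measurePreserving_update {ι : Type*} [Fintype ι] [DecidableEq ι] {α : ι → Type*}
    [∀ i, MeasurableSpace (α i)] (μ : ∀ i, Measure (α i)) [∀ i, IsProbabilityMeasure (μ i)]
    (i : ι) :
    MeasurePreserving (fun p : α i × (∀ j, α j) => Function.update p.2 i p.1)
      ((μ i).prod (Measure.pi μ)) (Measure.pi μ) := by
  have hm : Measurable (fun p : α i × (∀ j, α j) => Function.update p.2 i p.1) :=
    measurable_update'.comp measurable_swap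
  refine ⟨hm, (Measure.pi_eq fun s hs => ?_).symm⟩
  rw [Measure.map_apply hm (.univ_pi hs)]
  -- It suffices to test boxes. The old i-th coordinate is discarded, so that side of the box
  -- becomes everything and contributes mass 1.
  have : (fun p : α i × (∀ j, α j) => Function.update p.2 i p.1) ⁻¹' Set.univ.pi s
      = s i ×ˢ Set.univ.pi (Function.update s i Set.univ) := by
    ext ⟨t, c⟩
    simp only [Set.mem_preimage, Set.mem_univ_pi, Set.mem_prod]
    constructor
    · intro h
      refine ⟨by simpa using h i, fun j => ?_⟩
      by_cases hj : j = i
      · subst hj; simp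
      · simpa [hj] using h j
    · rintro ⟨h, h'⟩ j
      by_cases hj : j = i
      · subst hj; simpa using h
      · simpa [hj] using h' j
  rw [this, Measure.prod_prod, Measure.pi_pi, ← Finset.mul_prod_erase _ _ (Finset.mem_univ i),
    ← Finset.mul_prod_erase Finset.univ (fun j => μ j (s j)) (Finset.mem_univ i)]
  simp only [Function.update_self, measure_univ, one_mul]
  congr 1
  refine Finset.prod_congr rfl fun j hj => ?_
  rw [Function.update_of_ne (Finset.ne_of_mem_erase hj)]

/-- The expectation of `φ` at the random sum of the `a j`, where `j` contributes with
probability `p j`, independently of the others. -/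
noncomputable def blend {ι : Type*} [Fintype ι] [DecidableEq ι] (a : ι → ℕ) (φ : ℕ → ℝ)
    (p : ι → ℝ) : ℝ :=
  ∑ T ∈ Finset.univ.powerset,
    φ (∑ j ∈ T, a j) * ((∏ j ∈ T, p j) * ∏ j ∈ Finset.univ \ T, (1 - p j))

/-- The integrand depends only on the random set of indices with `c j ∈ S j`. Splitting by this set
turns it into a sum of products of one-coordinate functions, which independence integrates factor by
factor. -/
theorem integral_pi_sum_ite {ι : Type*} [Fintype ι] [DecidableEq ι] (μ : ι → Measure ℝ)
    [∀ i, IsProbabilityMeasure (μ i)] (a : ι → ℕ) (φ : ℕ → ℝ) {S : ι → Set ℝ}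
    (hS : ∀ i, MeasurableSet (S i)) :
    ∫ c, φ (∑ j, (S j).indicator (fun _ => a j) (c j)) ∂Measure.pi μ
      = blend a φ fun j => (μ j).real (S j) := by
  have hpt : ∀ c : ι → ℝ, φ (∑ j, (S j).indicator (fun _ => a j) (c j))
      = ∑ T ∈ Finset.univ.powerset, φ (∑ j ∈ T, a j) *
        ∏ j, (if j ∈ T then (S j).indicator 1 (c j) else 1 - (S j).indicator 1 (c j) : ℝ) := by
    classical
    intro c
    -- The product is the indicator of the event that `T` is exactly the set of j with `c j ∈ S j`.
    rw [Finset.sum_eq_single_of_mem (Finset.univ.filter fun j => c j ∈ S j) (by simp)]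
    · rw [Finset.prod_eq_one, mul_one, Finset.sum_filter]
      · simp [Set.indicator_apply]
      · intro j _
        by_cases h : c j ∈ S j <;> simp [h]
    · intro T _ hT
      obtain ⟨j, hj⟩ : ∃ j, ¬ (j ∈ T ↔ c j ∈ S j) := by
        by_contra! h
        exact hT (by ext j; simp [h])
      rw [Finset.prod_eq_zero (Finset.mem_univ j), mul_zero]
      by_cases h : c j ∈ S j <;> by_cases h' : j ∈ T <;> simp_all
  have hint : ∀ j, Integrable ((S j).indicator (1 : ℝ → ℝ)) (μ j) := fun j =>
    (integrable_const (1 : ℝ)).indicator (hS j)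
  have hmeas : ∀ j, Measurable ((S j).indicator (1 : ℝ → ℝ)) := fun j =>
    measurable_one.indicator (hS j)
  have hval : ∀ j, ∫ t, (S j).indicator (1 : ℝ → ℝ) t ∂μ j = (μ j).real (S j) := fun j =>
    integral_indicator_one (hS j)
  simp_rw [hpt]
  rw [integral_finsetSum]
  · refine Finset.sum_congr rfl fun T _ => ?_
    rw [integral_const_mul]
    congr 1
    rw [integral_fintype_prod_eq_prod
      (fun j t => (if j ∈ T then (S j).indicator 1 t else 1 - (S j).indicator 1 t : ℝ)),
      ← Finset.prod_mul_prod_compl T, Finset.compl_eq_univ_sdiff]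
    congr 1
    · refine Finset.prod_congr rfl fun j hj => ?_
      simp only [hj, if_true, hval]
    · refine Finset.prod_congr rfl fun j hj => ?_
      have hj' : j ∉ T := by simpa using hj
      simp only [hj', if_false]
      rw [integral_sub (integrable_const _) (hint j), hval]
      simp
  · intro T _
    refine Integrable.const_mul ?_ _
    exact Integrable.fintype_prod
      (f := fun j t => (if j ∈ T then (S j).indicator 1 t else 1 - (S j).indicator 1 t : ℝ))
      fun j => by
        by_cases h : j ∈ T
        · simpa only [h, if_true] using hint j
        · simp only [h, if_false]
          exact (integrable_const (1 : ℝ)).sub (hint j)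

/-! ### Tail probabilities of uniform variables and the expected share of an item. -/

/-- The probability that a random variable, uniform on `[l, r]`, exceeds `t`. -/
noncomputable def tail (l r t : ℝ) : ℝ := max 0 (min 1 ((r - t) / (r - l)))

theorem continuous_tail (l r : ℝ) : Continuous (tail l r) := by
  unfold tail
  fun_prop

theorem tail_eq_one {l r t : ℝ} (hlr : l < r) (h : t ≤ l) : tail l r t = 1 := by
  unfold tail
  rw [min_eq_left, max_eq_right zero_le_one]
  rw [le_div_iff₀ (by linarith)]
  linarith

theorem tail_eq_zero {l r t : ℝ} (hlr : l < r) (h : r ≤ t) : tail l r t = 0 := by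
  unfold tail
  refine max_eq_left ((min_le_right _ _).trans ?_)
  exact div_nonpos_of_nonpos_of_nonneg (by linarith) (by linarith)

theorem tail_eq_div {l r t : ℝ} (hlr : l < r) (h : l ≤ t) (h' : t ≤ r) :
    tail l r t = (r - t) / (r - l) := by
  have : 0 < r - l := by linarith
  unfold tail
  rw [min_eq_right, max_eq_right]
  · exact div_nonneg (by linarith) this.le
  · rw [div_le_one this]
    linarith

theorem tail_mul {l r t k : ℝ} (hk : 0 < k) : tail (l * k) (r * k) (t * k) = tail l r t := by
  unfold tail
  rw [← sub_mul, ← sub_mul, mul_div_mul_right _ _ hk.ne']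

namespace Instance

variable {n : ℕ} (I : Instance n)

theorem valueLaw_real_Ioi (i : Fin n) (t : ℝ) :
    (I.valueLaw i).real (Set.Ioi t) = tail (I.cLo i) (I.cHi i) t := by
  have hlt := I.cLo_lt_cHi i
  have hpos : 0 < I.cHi i - I.cLo i := by linarith
  rw [measureReal_def, valueLaw, ProbabilityTheory.cond_apply measurableSet_Icc]
  have : volume (Set.Icc (I.cLo i) (I.cHi i) ∩ Set.Ioi t)
      = ENNReal.ofReal (I.cHi i - max (I.cLo i) t) := by
    rw [measure_congr ((Ioc_ae_eq_Icc (μ := volume) (a := I.cLo i) (b := I.cHi i)).symm.inter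
      (ae_eq_refl (Set.Ioi t))), Set.Ioc_inter_Ioi, Real.volume_Ioc]
  rw [this, Real.volume_Icc, ENNReal.toReal_mul, ENNReal.toReal_inv,
    ENNReal.toReal_ofReal hpos.le, ENNReal.toReal_ofReal', inv_mul_eq_div]
  rcases le_total t (I.cLo i) with h | h
  · rw [tail_eq_one hlt h, max_eq_left h, max_eq_left hpos.le, div_self hpos.ne']
  · rw [max_eq_right h]
    rcases le_total t (I.cHi i) with h' | h'
    · rw [tail_eq_div hlt h h', max_eq_left (by linarith)]
    · rw [tail_eq_zero hlt h', max_eq_right (by linarith), zero_div]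

/-- Fubini after resampling coordinate i: an event is almost sure if it is so in that coordinate
alone, with the others frozen. -/
theorem ae_law_of_update {P : (Fin n → ℝ) → Prop} (hP : MeasurableSet {c | P c}) (i : Fin n)
    (h : ∀ c, ∀ᵐ t ∂I.valueLaw i, P (Function.update c i t)) : ∀ᵐ c ∂I.law, P c := by
  have hmp := measurePreserving_update I.valueLaw i
  have hm : MeasurableSet {p : ℝ × (Fin n → ℝ) | P (Function.update p.2 i p.1)} :=
    hmp.measurable hP
  change ∀ᵐ c ∂Measure.pi I.valueLaw, P c
  rw [← hmp.map_eq, ae_map_iff hmp.aemeasurable hP, ← Measure.prod_swap]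
  rw [ae_map_iff measurable_swap.aemeasurable hm]
  refine (Measure.ae_prod_iff_ae_ae (measurable_swap hm)).2 ?_
  exact .of_forall h

/-- With all other values frozen, each forbidden equation excludes a single value of `c i`, and the
one-dimensional laws have no atoms. -/
theorem ae_generic : ∀ᵐ c : Fin n → ℝ ∂I.law, (∀ i, c i ≠ 0) ∧
    ∀ i j, i ≠ j → c i * I.a j ≠ c j * I.a i := by
  refine (ae_all_iff.2 fun i => ?_).and
    (ae_all_iff.2 fun i => ae_all_iff.2 fun j => ?_)
  · refine I.ae_law_of_update (measurableSet_eq_fun (by fun_prop) (by fun_prop)).compl i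
      fun c => ?_
    simp only [Function.update_self]
    exact (Set.countable_singleton (0 : ℝ)).ae_notMem _
  · by_cases hij : i = j
    · simp [hij]
    · have ha : (I.a j : ℝ) ≠ 0 := Nat.cast_ne_zero.2 (I.a_pos j).ne'
      have : ∀ᵐ c : Fin n → ℝ ∂I.law, c i * I.a j ≠ c j * I.a i := by
        refine I.ae_law_of_update (measurableSet_eq_fun (by fun_prop) (by fun_prop)).compl i
          fun c => ?_
        simp only [Function.update_self, Function.update_of_ne (Ne.symm hij)]
        filter_upwards [(Set.countable_singleton (c j * I.a i / I.a j)).ae_notMem (I.valueLaw i)]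
          with t ht h
        exact ht (by rw [Set.mem_singleton_iff, eq_div_iff ha, h])
      filter_upwards [this] with c hc _ using hc

theorem measurable_share (b : ℝ) (i : Fin n) : Measurable fun c => I.share b c i := by
  have h1 : Measurable fun c => I.ahead c i := by
    unfold ahead
    refine Finset.measurable_sum _ fun j _ => ?_
    exact Measurable.ite (measurableSet_lt (by fun_prop) (by fun_prop)) measurable_const
      measurable_const
  unfold share
  exact Measurable.ite (measurableSet_lt (by fun_prop) (by fun_prop))
    ((measurable_from_nat (f := fill b (I.a i))).comp h1) measurable_const

theorem share_mem_Icc (b : ℝ) (c : Fin n → ℝ) (i : Fin n) : I.share b c i ∈ Set.Icc (0 : ℝ) 1 := by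
  unfold share
  split_ifs
  · exact ⟨fill_nonneg _ _ _, fill_le_one _ _ _⟩
  · simp

theorem integrable_share (b : ℝ) (i : Fin n) : Integrable (fun c => I.share b c i) I.law :=
  Integrable.of_mem_Icc 0 1 (I.measurable_share b i).aemeasurable
    (.of_forall fun c => I.share_mem_Icc b c i)

/-- The probability that item `j` precedes item `i` if item `i` has the value `t`. -/
noncomputable def precede (i : Fin n) (t : ℝ) (j : Fin n) : ℝ :=
  if j = i then 0 else tail (I.cLo j * I.a i / I.a j) (I.cHi j * I.a i / I.a j) t

/-- The expected share of item `i` if it has the value `t > 0`. -/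
noncomputable def condShare (b : ℝ) (i : Fin n) (t : ℝ) : ℝ :=
  blend I.a (fill b (I.a i)) (I.precede i t)

theorem continuous_condShare (b : ℝ) (i : Fin n) : Continuous (I.condShare b i) := by
  unfold condShare blend precede
  refine continuous_finsetSum _ fun T _ => .mul continuous_const (.mul ?_ ?_)
  · refine continuous_finsetProd _ fun j _ => ?_
    split_ifs
    · exact continuous_const
    · exact continuous_tail _ _
  · refine continuous_finsetProd _ fun j _ => continuous_const.sub ?_
    split_ifs
    · exact continuous_const
    · exact continuous_tail _ _

theorem integral_share_update (b : ℝ) (i : Fin n) (t : ℝ) :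
    ∫ c, I.share b (Function.update c i t) i ∂I.law = if 0 < t then I.condShare b i t else 0 := by
  unfold share
  simp only [Function.update_self]
  split_ifs with ht
  swap
  · simp
  -- Item j precedes item i exactly when `c j` exceeds `t * a j / a i`; the empty set keeps item i
  -- from preceding itself.
  have hW : ∀ c : Fin n → ℝ, I.ahead (Function.update c i t) i
      = ∑ j, ((if j = i then ∅ else Set.Ioi (t * I.a j / I.a i)) : Set ℝ).indicator
          (fun _ => I.a j) (c j) := by
    intro c
    unfold ahead
    refine Finset.sum_congr rfl fun j _ => ?_
    have ha : (0 : ℝ) < I.a i := Nat.cast_pos.2 (I.a_pos i)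
    by_cases hj : j = i
    · subst hj; simp
    · simp [hj, Set.indicator_apply, div_lt_iff₀ ha]
  simp_rw [hW]
  refine (integral_pi_sum_ite I.valueLaw I.a (fill b (I.a i)) fun j => ?_).trans ?_
  · split_ifs <;> simp
  · unfold condShare precede
    congr 1
    funext j
    split_ifs
    · simp
    · have hi : (0 : ℝ) < I.a i := Nat.cast_pos.2 (I.a_pos i)
      have hj : (0 : ℝ) < I.a j := Nat.cast_pos.2 (I.a_pos j)
      -- Rescaling by `a i / a j` moves the dependence on the sizes from the threshold to the
      -- interval end points.
      rw [valueLaw_real_Ioi, ← tail_mul (div_pos hi hj)]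
      congr 1 <;> field_simp

/-- Condition on the value of item i by resampling it. Negative values contribute nothing, and the
maximum in the upper limit makes the integral zero when the interval has no positive part. -/
theorem integral_share (b : ℝ) (i : Fin n) :
    ∫ c, I.share b c i ∂I.law = (I.cHi i - I.cLo i)⁻¹ *
      ∫ t in (max (I.cLo i) 0)..(max (I.cHi i) (max (I.cLo i) 0)), I.condShare b i t := by
  have hmp := measurePreserving_update I.valueLaw i
  have hpos : 0 < I.cHi i - I.cLo i := by linarith [I.cLo_lt_cHi i]
  have hs := I.integrable_share b i
  have h1 : ∫ c, I.share b c i ∂I.law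
      = ∫ t, ∫ c, I.share b (Function.update c i t) i ∂I.law ∂I.valueLaw i := by
    have hi : Integrable (fun p : ℝ × (Fin n → ℝ) => I.share b (Function.update p.2 i p.1) i)
        ((I.valueLaw i).prod I.law) := hmp.integrable_comp_of_integrable hs
    rw [← integral_prod _ hi]
    change ∫ c, I.share b c i ∂Measure.pi I.valueLaw = _
    conv_lhs => rw [← hmp.map_eq]
    rw [integral_map hmp.aemeasurable (I.measurable_share b i).aestronglyMeasurable]
    rfl
  rw [h1]
  simp_rw [integral_share_update]
  have h2 : (fun t : ℝ => if 0 < t then I.condShare b i t else 0)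
      = (Set.Ioi 0).indicator (I.condShare b i) := by
    funext t
    simp [Set.indicator_apply]
  rw [h2, valueLaw, ProbabilityTheory.cond, integral_smul_measure, Real.volume_Icc,
    ENNReal.toReal_inv, ENNReal.toReal_ofReal hpos.le, smul_eq_mul,
    setIntegral_congr_set Ioc_ae_eq_Icc.symm, setIntegral_indicator measurableSet_Ioi,
    Set.Ioc_inter_Ioi, intervalIntegral.integral_of_le (le_max_right _ _)]
  congr 3
  rcases le_total (I.cHi i) (max (I.cLo i) 0) with h | h
  · rw [max_eq_right h, Set.Ioc_eq_empty (not_lt.2 h), Set.Ioc_self]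
  · rw [max_eq_left h]

/-- The leader's expected payoff for the capacity `b`. -/
noncomputable def value (b : ℝ) : ℝ := ∑ i, (I.d i : ℝ) * ∫ c, I.share b c i ∂I.law - I.δ * b

theorem reaction_payoff {X : ℝ → (Fin n → ℝ) → (Fin n → ℝ)} (hX : I.IsReaction X) {b : ℝ}
    (hb : b ∈ Set.Icc I.bLo I.bHi) :
    (fun c => I.payoff b (X b c)) =ᵐ[I.law] fun c => I.payoff b (I.share b c) := by
  filter_upwards [hX b hb, I.ae_generic] with c hc hg
  congr 1
  funext i
  exact optimal_eq_share hc hg.1 hg.2 i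

theorem integrable_payoff_share (b : ℝ) :
    Integrable (fun c => I.payoff b (I.share b c)) I.law := by
  unfold payoff
  exact (integrable_finsetSum _ fun i _ => (I.integrable_share b i).const_mul _).sub
    (integrable_const _)

theorem expectedPayoff_eq_value {X : ℝ → (Fin n → ℝ) → (Fin n → ℝ)} (hX : I.IsReaction X) {b : ℝ}
    (hb : b ∈ Set.Icc I.bLo I.bHi) : I.expectedPayoff X b = I.value b := by
  unfold expectedPayoff
  rw [integral_congr_ae (I.reaction_payoff hX hb)]
  unfold payoff value
  rw [integral_sub (integrable_finsetSum _ fun i _ => (I.integrable_share b i).const_mul _)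
    (integrable_const _), integral_finsetSum _ fun i _ => (I.integrable_share b i).const_mul _]
  simp [integral_const_mul]

theorem isSolution_of_value {b v : ℝ} (hb : b ∈ Set.Icc I.bLo I.bHi) (hv : I.value b = v)
    (hmax : ∀ b' ∈ Set.Icc I.bLo I.bHi, I.value b' ≤ v) : I.IsSolution b v := by
  refine ⟨hb, I.exists_isReaction, fun X hX => ⟨fun b' hb' => ?_, fun b' hb' => ?_, ?_⟩⟩
  · exact (I.integrable_payoff_share b').congr (I.reaction_payoff hX hb').symm
  · change I.expectedPayoff X b' ≤ I.expectedPayoff X b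
    rw [I.expectedPayoff_eq_value hX hb, I.expectedPayoff_eq_value hX hb', hv]
    exact hmax b' hb'
  · rw [I.expectedPayoff_eq_value hX hb, hv]

end Instance

/-! ## Products of two-variable polynomials as products of one-variable polynomials -/

/-- The coefficient sequence of a polynomial, preceded by `0`. -/
noncomputable def shiftedCoeff (P : Polynomial ℝ) (y : ℕ) : ℝ :=
  if y = 0 then 0 else P.coeff (y - 1)

/-- No case distinction is needed: when `s` exceeds the index, truncated subtraction lands on entry
0, which holds the value 0. -/
theorem shiftedCoeff_mul_X_pow (P : Polynomial ℝ) (s y : ℕ) :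
    shiftedCoeff (P * Polynomial.X ^ s) y = shiftedCoeff P (y - s) := by
  unfold shiftedCoeff
  rw [Polynomial.coeff_mul_X_pow']
  by_cases hy : y = 0
  · simp [hy]
  · by_cases h : s ≤ y - 1
    · rw [if_neg hy, if_pos h, if_neg (by omega)]
      congr 1
      omega
    · rw [if_neg hy, if_neg h, if_pos (by omega)]

/-- The factor of an item whose weight is encoded by `X ^ s` and that is packed with
probability `p + r * X`. -/
noncomputable def factor (s : ℕ) (p r : ℝ) : Polynomial ℝ :=
  (Polynomial.C p + Polynomial.C r * Polynomial.X) * Polynomial.X ^ s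
    + (1 - (Polynomial.C p + Polynomial.C r * Polynomial.X))

/-- Expanded, the factor is `(1 - p) - r X + p X ^ s + r X ^ (s + 1)`. All indices on the right are
at most `y`, which permits updating in place. -/
theorem shiftedCoeff_mul_factor (P : Polynomial ℝ) (s : ℕ) (p r : ℝ) (y : ℕ) :
    shiftedCoeff (P * factor s p r) y
      = (1 - p) * shiftedCoeff P y - r * shiftedCoeff P (y - 1)
        + p * shiftedCoeff P (y - s) + r * shiftedCoeff P (y - (s + 1)) := by
  have h : P * factor s p r = Polynomial.C (1 - p) * P - Polynomial.C r * (P * Polynomial.X ^ 1)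
      + Polynomial.C p * (P * Polynomial.X ^ s)
      + Polynomial.C r * (P * Polynomial.X ^ (s + 1)) := by
    unfold factor
    simp only [map_sub, map_one]
    ring
  have hadd : ∀ Q R : Polynomial ℝ,
      shiftedCoeff (Q + R) y = shiftedCoeff Q y + shiftedCoeff R y := by
    intro Q R
    unfold shiftedCoeff
    split_ifs <;> simp
  have hsub : ∀ Q R : Polynomial ℝ,
      shiftedCoeff (Q - R) y = shiftedCoeff Q y - shiftedCoeff R y := by
    intro Q R
    unfold shiftedCoeff
    split_ifs <;> simp
  have hC : ∀ (k : ℝ) (Q : Polynomial ℝ),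
      shiftedCoeff (Polynomial.C k * Q) y = k * shiftedCoeff Q y := by
    intro k Q
    unfold shiftedCoeff
    split_ifs <;> simp
  rw [h, hadd, hadd, hsub, hC, hC, hC, hC, shiftedCoeff_mul_X_pow, shiftedCoeff_mul_X_pow,
    shiftedCoeff_mul_X_pow]

/-- The integral over `[0, h]` of the part of weight `w`. -/
noncomputable def blockIntegral (n : ℕ) (h : ℝ) (P : Polynomial ℝ) (w : ℕ) : ℝ :=
  ∑ e ∈ Finset.range (n + 1), P.coeff (w * (n + 1) + e) * h ^ (e + 1) / (e + 1)

/-- The integral over `[0, h]` of the sum of the parts, each weighted with `φ`. -/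
noncomputable def weightedIntegral (n A : ℕ) (φ : ℕ → ℝ) (h : ℝ) (P : Polynomial ℝ) : ℝ :=
  ∑ w ∈ Finset.range (A + 1), φ w * blockIntegral n h P w

theorem weightedIntegral_sum {ι : Type*} (n A : ℕ) (φ : ℕ → ℝ) (h : ℝ) (s : Finset ι)
    (P : ι → Polynomial ℝ) : weightedIntegral n A φ h (∑ T ∈ s, P T)
      = ∑ T ∈ s, weightedIntegral n A φ h (P T) := by
  unfold weightedIntegral blockIntegral
  rw [Finset.sum_comm]
  refine Finset.sum_congr rfl fun w _ => ?_
  rw [← Finset.mul_sum, Finset.sum_comm]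
  congr 1
  refine Finset.sum_congr rfl fun e _ => ?_
  rw [Polynomial.finsetSum_coeff, Finset.sum_mul, Finset.sum_div]

/-- A polynomial of degree at most n, shifted by `w * (n + 1)`, stays within the w-th block of n + 1
exponents, so no other block sees it. -/
theorem weightedIntegral_X_pow_mul {n A w : ℕ} (φ : ℕ → ℝ) (h : ℝ) {P : Polynomial ℝ}
    (hP : P.natDegree ≤ n) (hw : w ≤ A) :
    weightedIntegral n A φ h (Polynomial.X ^ (w * (n + 1)) * P)
      = φ w * ∫ u in (0 : ℝ)..h, P.eval u := by
  unfold weightedIntegral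
  rw [Finset.sum_eq_single_of_mem w (by simp; omega)]
  · congr 1
    simp_rw [Polynomial.eval_eq_sum_range' (Nat.lt_succ_of_le hP)]
    rw [intervalIntegral.integral_finsetSum fun e _ =>
      (by fun_prop : Continuous fun u : ℝ => P.coeff e * u ^ e).intervalIntegrable _ _]
    refine Finset.sum_congr rfl fun e _ => ?_
    rw [intervalIntegral.integral_const_mul, integral_pow, Polynomial.coeff_X_pow_mul',
      if_pos (Nat.le_add_right _ _), Nat.add_sub_cancel_left]
    simp [mul_div_assoc]
  · intro v _ hv
    refine mul_eq_zero_of_right _ (Finset.sum_eq_zero fun e he => ?_)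
    have he' : e < n + 1 := Finset.mem_range.1 he
    rw [Polynomial.coeff_X_pow_mul']
    rcases Nat.lt_or_gt_of_ne hv with hlt | hlt
    · have : (v + 1) * (n + 1) ≤ w * (n + 1) := Nat.mul_le_mul_right _ hlt
      rw [if_neg (by rw [Nat.succ_mul] at this; omega)]
      simp
    · have : (w + 1) * (n + 1) ≤ v * (n + 1) := Nat.mul_le_mul_right _ hlt
      rw [Nat.succ_mul] at this
      rw [if_pos (by omega), Polynomial.coeff_eq_zero_of_natDegree_lt (by omega)]
      simp

theorem natDegree_prod_mul_prod_le {ι : Type*} [Fintype ι] [DecidableEq ι]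
    {f g : ι → Polynomial ℝ} (hf : ∀ j, (f j).natDegree ≤ 1) (hg : ∀ j, (g j).natDegree ≤ 1)
    (T : Finset ι) :
    ((∏ j ∈ T, f j) * ∏ j ∈ Finset.univ \ T, g j).natDegree ≤ Fintype.card ι := by
  have h1 := (Polynomial.natDegree_prod_le T f).trans
    (Finset.sum_le_card_nsmul T _ 1 fun j _ => hf j)
  have h2 := (Polynomial.natDegree_prod_le (Finset.univ \ T) g).trans
    (Finset.sum_le_card_nsmul (Finset.univ \ T) _ 1 fun j _ => hg j)
  have h3 := Finset.card_sdiff_add_card_eq_card (Finset.subset_univ T)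
  rw [Finset.card_univ] at h3
  simp only [smul_eq_mul, mul_one] at h1 h2
  exact Polynomial.natDegree_mul_le.trans (by omega)

/-- Expanding the product over the set `T` of preceding items reproduces the expansion in `blend`:
each term is a power of X encoding the weight of `T`, times a polynomial in u of degree at most the
number of items. -/
theorem weightedIntegral_prod {ι : Type*} [Fintype ι] [DecidableEq ι] {n A : ℕ}
    (hn : Fintype.card ι ≤ n) (a : ι → ℕ) (hA : ∑ j, a j ≤ A) (φ : ℕ → ℝ) (h : ℝ)
    {L : ι → Polynomial ℝ} (hL : ∀ j, (L j).natDegree ≤ 1) :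
    weightedIntegral n A φ h (∏ j, (L j * Polynomial.X ^ (a j * (n + 1)) + (1 - L j)))
      = ∫ u in (0 : ℝ)..h, blend a φ fun j => (L j).eval u := by
  have hL' : ∀ j, (1 - L j).natDegree ≤ 1 := fun j =>
    (Polynomial.natDegree_sub_le _ _).trans (by simpa using hL j)
  rw [Finset.prod_add, weightedIntegral_sum]
  unfold blend
  rw [intervalIntegral.integral_finsetSum]
  · refine Finset.sum_congr rfl fun T _ => ?_
    have hsplit : (∏ j ∈ T, L j * Polynomial.X ^ (a j * (n + 1)))
        * ∏ j ∈ Finset.univ \ T, (1 - L j)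
        = Polynomial.X ^ ((∑ j ∈ T, a j) * (n + 1)) *
          ((∏ j ∈ T, L j) * ∏ j ∈ Finset.univ \ T, (1 - L j)) := by
      rw [Finset.prod_mul_distrib, Finset.prod_pow_eq_pow_sum, Finset.sum_mul]
      ring
    rw [hsplit, weightedIntegral_X_pow_mul _ _ ((natDegree_prod_mul_prod_le hL hL' T).trans hn)
      ((Finset.sum_le_univ_sum_of_nonneg fun _ => Nat.zero_le _).trans hA),
      intervalIntegral.integral_const_mul]
    simp only [Polynomial.eval_mul, Polynomial.eval_prod, Polynomial.eval_sub,
      Polynomial.eval_one]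
  · intro T _
    refine Continuous.intervalIntegrable ?_ _ _
    exact .mul continuous_const
      (.mul (continuous_finsetProd _ fun j _ => (L j).continuous)
        (continuous_finsetProd _ fun j _ => continuous_const.sub (L j).continuous))

theorem weightedIntegral_prod_factor {ι : Type*} [Fintype ι] [DecidableEq ι] {n A : ℕ}
    (hn : Fintype.card ι ≤ n) (a : ι → ℕ) (hA : ∑ j, a j ≤ A) (φ : ℕ → ℝ) (h : ℝ)
    (p r : ι → ℝ) :
    weightedIntegral n A φ h (∏ j, factor (a j * (n + 1)) (p j) (r j))
      = ∫ u in (0 : ℝ)..h, blend a φ fun j => p j + r j * u := by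
  unfold factor
  rw [weightedIntegral_prod hn a hA φ h
    (L := fun j => Polynomial.C (p j) + Polynomial.C (r j) * Polynomial.X)
    fun j => by compute_degree]
  simp

/-! ## Piecewise linear functions -/

/-- The function with the slope changes `D m` at the points `m`. -/
noncomputable def hinge (M : ℕ) (D : ℕ → ℝ) (b : ℝ) : ℝ :=
  ∑ m ∈ Finset.range M, D m * max (b - m) 0

theorem hinge_update {M k : ℕ} (hk : k < M) (D : ℕ → ℝ) (v b : ℝ) :
    hinge M (Function.update D k (D k + v)) b = hinge M D b + v * max (b - k) 0 := by
  unfold hinge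
  have hmem := Finset.mem_range.2 hk
  rw [← Finset.add_sum_erase _ _ hmem, ← Finset.add_sum_erase _ _ hmem, Function.update_self,
    Finset.sum_congr rfl fun m hm => by rw [Function.update_of_ne (Finset.ne_of_mem_erase hm)]]
  ring

/-- The used part of an item grows with slope 1 between the capacities w and w + a and is constant
elsewhere: one slope change up, one down. -/
theorem max_sub_max_eq_mul_fill (b : ℝ) {a : ℕ} (ha : 0 < a) (w : ℕ) :
    max (b - w) 0 - max (b - (w + a : ℕ)) 0 = a * fill b a w := by
  have ha' : (0 : ℝ) < a := Nat.cast_pos.2 ha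
  unfold fill
  rw [Nat.cast_add]
  rcases le_total b w with h | h
  · have h1 : (b - w) / a ≤ 0 := div_nonpos_of_nonpos_of_nonneg (by linarith) ha'.le
    rw [max_eq_right (by linarith), max_eq_right (by linarith),
      max_eq_left ((min_le_right _ _).trans h1)]
    simp
  · have h1 : 0 ≤ (b - w) / a := div_nonneg (by linarith) ha'.le
    rcases le_total b (w + a) with h' | h'
    · have h2 : (b - w) / a ≤ 1 := by
        rw [div_le_one ha']
        linarith
      rw [max_eq_left (by linarith), max_eq_right (by linarith), min_eq_right h2,
        max_eq_right h1]
      field_simp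
      ring
    · have h2 : 1 ≤ (b - w) / a := by
        rw [one_le_div ha']
        linarith
      rw [max_eq_left (by linarith), max_eq_left (by linarith), min_eq_left h2,
        max_eq_right zero_le_one]
      ring

/-! ## The program -/

attribute [simp] IExp.eval RExp.eval Test.Holds IExp.cost RExp.cost Test.cost

namespace Mem

variable (m : Mem)

@[simp] theorem state_ivar_n : m.state.ivar 0 = m.n := rfl
@[simp] theorem state_ivar_A : m.state.ivar 1 = m.A := rfl
@[simp] theorem state_ivar_i : m.state.ivar 2 = m.i := rfl
@[simp] theorem state_ivar_j : m.state.ivar 3 = m.j := rfl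
@[simp] theorem state_ivar_w : m.state.ivar 4 = m.w := rfl
@[simp] theorem state_ivar_e : m.state.ivar 5 = m.e := rfl
@[simp] theorem state_ivar_y : m.state.ivar 6 = m.y := rfl
@[simp] theorem state_rvar_delta : m.state.rvar 0 = m.δ := rfl
@[simp] theorem state_rvar_bLo : m.state.rvar 1 = m.bLo := rfl
@[simp] theorem state_rvar_bHi : m.state.rvar 2 = m.bHi := rfl
@[simp] theorem state_rvar_t : m.state.rvar 3 = m.t := rfl
@[simp] theorem state_rvar_u : m.state.rvar 4 = m.u := rfl
@[simp] theorem state_rvar_p : m.state.rvar 5 = m.p := rfl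
@[simp] theorem state_rvar_r : m.state.rvar 6 = m.r := rfl
@[simp] theorem state_rvar_q : m.state.rvar 7 = m.q := rfl
@[simp] theorem state_rvar_z : m.state.rvar 8 = m.z := rfl
@[simp] theorem state_rvar_val : m.state.rvar 9 = m.val := rfl
@[simp] theorem state_rvar_slope : m.state.rvar 10 = m.slope := rfl
@[simp] theorem state_rvar_best : m.state.rvar 11 = m.best := rfl
@[simp] theorem state_rvar_arg : m.state.rvar 12 = m.arg := rfl
@[simp] theorem state_rvar_cand : m.state.rvar 13 = m.cand := rfl
@[simp] theorem state_iarr_a : m.state.iarr 0 = m.a := rfl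
@[simp] theorem state_rarr_lo : m.state.rarr 0 = m.lo := rfl
@[simp] theorem state_rarr_hi : m.state.rarr 1 = m.hi := rfl
@[simp] theorem state_rarr_d : m.state.rarr 2 = m.d := rfl
@[simp] theorem state_rarr_G : m.state.rarr 3 = m.G := rfl
@[simp] theorem state_rarr_D : m.state.rarr 4 = m.D := rfl

/-- The value of the current item `m.i` at which it is as efficient as item `k` with the value
`m.lo k`. -/
noncomputable def breakLo (k : ℕ) : ℝ := m.lo k * m.a m.i / m.a k

/-- The value of the current item `m.i` at which it is as efficient as item `k` with the value
`m.hi k`. -/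
noncomputable def breakHi (k : ℕ) : ℝ := m.hi k * m.a m.i / m.a k

/-- The probability that item `k` precedes the current item if that one has the value `m.t`. -/
noncomputable def intercept (k : ℕ) : ℝ :=
  if k = m.i then 0
  else if m.breakHi k ≤ m.t then 0
  else if m.breakLo k ≤ m.t then (m.breakHi k - m.t) / (m.breakHi k - m.breakLo k)
  else 1

/-- The derivative of the probability that item `k` precedes the current item. -/
noncomputable def incline (k : ℕ) : ℝ :=
  if k = m.i then 0
  else if m.breakHi k ≤ m.t then 0
  else if m.breakLo k ≤ m.t then 0 - 1 / (m.breakHi k - m.breakLo k)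
  else 0

/-- The factor of item `k` for the current item and the current interval. -/
noncomputable def itemFactor (k : ℕ) : Polynomial ℝ :=
  factor (m.a k * (m.n + 1)) (m.intercept k) (m.incline k)

/-- The array `G` stores the coefficients of `P`. -/
def Stores (P : Polynomial ℝ) : Prop :=
  ∀ y ≤ (m.A + 1) * (m.n + 1), m.G y = shiftedCoeff P y

end Mem

namespace WP

variable {p q : Program} {K K₁ K₂ : ℕ} {Q R : Mem → Prop} {m : Mem}

theorem comp (h : WP p K₁ (WP q K₂ Q) m) : WP (.seq p q) (K₁ + K₂) Q m :=
  h.seq fun _ => id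

/-- Adding the two bounds instead of taking their maximum is wasteful by a constant only, and lets
the cost be read off from the rules used. -/
theorem branch {t : Test} (h : t.Holds m.state → WP p K₁ Q m)
    (h' : ¬ t.Holds m.state → WP q K₂ Q m) : WP (.ite t p q) (t.cost + (K₁ + K₂)) Q m :=
  ite (fun ht => (h ht).le (Nat.le_add_right _ _)) fun ht => (h' ht).le (Nat.le_add_left _ _)

end WP

namespace Program

/-- Compute the total item size. -/
def totalSize : Program :=
  .loop (.ile (.add (.var 3) (.const 1)) (.var 0))
    (.seq (.isetVar 1 (.add (.var 1) (.get 0 (.var 3))))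
      (.isetVar 3 (.add (.var 3) (.const 1))))

/-- The expression for `Mem.breakLo`. -/
def breakLo : RExp :=
  .div (.mul (.get 0 (.var 3)) (.ofIndex (.get 0 (.var 2)))) (.ofIndex (.get 0 (.var 3)))

/-- The expression for `Mem.breakHi`. -/
def breakHi : RExp :=
  .div (.mul (.get 1 (.var 3)) (.ofIndex (.get 0 (.var 2)))) (.ofIndex (.get 0 (.var 3)))

/-- Replace the next break point by `e` if `e` is a smaller one. -/
def relax (e : RExp) : Program :=
  .ite (.rle e (.var 3)) .skip (.ite (.rle (.var 4) e) .skip (.rsetVar 4 e))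

/-- Compute the next break point. -/
def nextBreak : Program :=
  .seq (.rsetVar 4 (.get 1 (.var 2))) <| .seq (.isetVar 3 (.const 0)) <|
  .loop (.ile (.add (.var 3) (.const 1)) (.var 0)) <|
    .seq (relax breakLo) <| .seq (relax breakHi) <| .isetVar 3 (.add (.var 3) (.const 1))

/-- The number of coefficients. -/
def tableSize : IExp := .mul (.add (.var 1) (.const 1)) (.add (.var 0) (.const 1))

/-- Store the polynomial `1`. -/
def clear : Program :=
  .seq (.isetVar 6 (.const 0)) <|
  .seq (.loop (.ile (.var 6) tableSize) <|
    .seq (.rsetArr 3 (.var 6) (.ofIndex (.const 0))) <| .isetVar 6 (.add (.var 6) (.const 1))) <|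
  .rsetArr 3 (.const 1) (.ofIndex (.const 1))

/-- Compute `Mem.intercept` and `Mem.incline`. -/
def linearize : Program :=
  .seq (.ite (.rle breakHi (.var 3))
      (.seq (.rsetVar 5 (.ofIndex (.const 0))) (.rsetVar 6 (.ofIndex (.const 0))))
      (.ite (.rle breakLo (.var 3))
        (.seq (.rsetVar 5 (.div (.sub breakHi (.var 3)) (.sub breakHi breakLo)))
          (.rsetVar 6 (.sub (.ofIndex (.const 0))
            (.div (.ofIndex (.const 1)) (.sub breakHi breakLo)))))
        (.seq (.rsetVar 5 (.ofIndex (.const 1))) (.rsetVar 6 (.ofIndex (.const 0)))))) <|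
  .ite (.ile (.var 3) (.var 2))
    (.ite (.ile (.var 2) (.var 3))
      (.seq (.rsetVar 5 (.ofIndex (.const 0))) (.rsetVar 6 (.ofIndex (.const 0)))) .skip)
    .skip

/-- Multiply the stored polynomial by the factor of an item. -/
def multiply : Program :=
  .seq (.isetVar 6 tableSize) <|
  .loop (.ile (.const 1) (.var 6)) <|
    .seq (.rsetArr 3 (.var 6)
      (.add (.add (.sub
        (.mul (.sub (.ofIndex (.const 1)) (.var 5)) (.get 3 (.var 6)))
        (.mul (.var 6) (.get 3 (.sub (.var 6) (.const 1)))))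
        (.mul (.var 5) (.get 3 (.sub (.var 6)
          (.mul (.get 0 (.var 3)) (.add (.var 0) (.const 1)))))))
        (.mul (.var 6) (.get 3 (.sub (.var 6)
          (.add (.mul (.get 0 (.var 3)) (.add (.var 0) (.const 1))) (.const 1))))))) <|
    .isetVar 6 (.sub (.var 6) (.const 1))

end Program

open Program

/-! ### Total size, break points, and multiplication by one factor. -/

namespace WP

variable {Q : Mem → Prop} {m : Mem}

theorem totalSize : WP totalSize (20 * (m.n + 1))
    (fun m' => m' = { m with j := m.n, A := ∑ k ∈ Finset.range m.n, m.a k })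
    { m with j := 0, A := 0 } := by
  apply WP.le
  · apply WP.loop (fun m' => ∃ j ≤ m.n,
      m' = { m with j := j, A := ∑ k ∈ Finset.range j, m.a k }) (fun m' => m.n - m'.j)
        (M := m.n) (hM := by simp)
    case hm => exact ⟨0, Nat.zero_le _, by simp⟩
    swap
    · rintro _ ⟨j, hj, rfl⟩ ht
      simp at ht
      rw [show j = m.n by omega]
    · rintro _ ⟨j, hj, rfl⟩ ht
      simp at ht
      apply comp
      apply setA
      apply setJ
      exact ⟨⟨j + 1, by omega, by simp [Finset.sum_range_succ]⟩, by simp; omega⟩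
  · simp
    omega

theorem relax {e : RExp} (htu : m.t < m.u)
    (h : ∀ u, u = m.u ∨ u = e.eval m.state → m.t < u → u ≤ m.u →
      e.eval m.state ≤ m.t ∨ u ≤ e.eval m.state → Q { m with u := u }) :
    WP (relax e) (3 * e.cost + 10) Q m := by
  apply WP.le
  · apply branch
    · intro ht
      exact .skip (h m.u (.inl rfl) htu le_rfl (.inl ht))
    · intro ht
      simp at ht
      apply branch
      · intro ht'
        exact .skip (h m.u (.inl rfl) htu le_rfl (.inr ht'))
      · intro ht'
        simp at ht'
        exact setUReal (h _ (.inr rfl) ht ht'.le (.inr le_rfl))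
  · simp
    omega

theorem nextBreak (hi : m.i < m.n) (ha : m.a m.i ≠ 0) (ht : m.t < m.hi m.i) :
    WP nextBreak (100 * (m.n + 1))
      (fun m' => ∃ u, m' = { m with j := m.n, u := u } ∧ m.t < u ∧ u ≤ m.hi m.i ∧
        (∃ k < m.n, u = m.breakLo k ∨ u = m.breakHi k) ∧
        ∀ k < m.n, (m.breakLo k ≤ m.t ∨ u ≤ m.breakLo k) ∧
          (m.breakHi k ≤ m.t ∨ u ≤ m.breakHi k)) m := by
  apply WP.le
  · apply comp
    apply setUReal
    apply comp
    apply setJ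
    apply WP.loop (fun m' => ∃ j ≤ m.n, ∃ u, m' = { m with j := j, u := u } ∧ m.t < u ∧
        u ≤ m.hi m.i ∧ (∃ k < m.n, u = m.breakLo k ∨ u = m.breakHi k) ∧
        ∀ k < j, (m.breakLo k ≤ m.t ∨ u ≤ m.breakLo k) ∧
          (m.breakHi k ≤ m.t ∨ u ≤ m.breakHi k)) (fun m' => m.n - m'.j)
        (M := m.n) (hM := by simp)
    -- The initial candidate, the right end point of the current item, is that item's own break
    -- point.
    case hm => exact ⟨0, Nat.zero_le _, m.hi m.i, by simp, ht, le_rfl,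
        ⟨m.i, hi, .inr (by simp [Mem.breakHi, ha])⟩, by simp⟩
    swap
    · rintro _ ⟨j, hj, u, rfl, h⟩ ht
      simp at ht
      obtain rfl : j = m.n := by omega
      exact ⟨u, rfl, h⟩
    · rintro _ ⟨j, hj, u, rfl, h1, h2, h3, h4⟩ ht
      simp at ht
      apply comp
      refine relax (by exact h1) fun u₁ hu₁ htu₁ hle₁ hor₁ => ?_
      apply comp
      refine relax (by exact htu₁) fun u₂ hu₂ htu₂ hle₂ hor₂ => ?_
      apply setJ
      replace hu₁ : u₁ = u ∨ u₁ = m.breakLo j := hu₁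
      replace hu₂ : u₂ = u₁ ∨ u₂ = m.breakHi j := hu₂
      replace hor₁ : m.breakLo j ≤ m.t ∨ u₁ ≤ m.breakLo j := hor₁
      replace hor₂ : m.breakHi j ≤ m.t ∨ u₂ ≤ m.breakHi j := hor₂
      replace hle₁ : u₁ ≤ u := hle₁
      replace hle₂ : u₂ ≤ u₁ := hle₂
      refine ⟨⟨j + 1, by omega, u₂, rfl, htu₂, hle₂.trans (hle₁.trans h2), ?_, ?_⟩, ?_⟩
      · rcases hu₂ with rfl | rfl
        · rcases hu₁ with rfl | rfl
          · exact h3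
          · exact ⟨j, by omega, .inl rfl⟩
        · exact ⟨j, by omega, .inr rfl⟩
      · intro k hk
        rcases Nat.lt_succ_iff_lt_or_eq.1 hk with hk | rfl
        · exact ⟨(h4 k hk).1.imp id (by intro h; linarith),
            (h4 k hk).2.imp id (by intro h; linarith)⟩
        · exact ⟨hor₁.imp id (by intro h; linarith), hor₂⟩
      · simp
        omega
  · simp [breakLo, breakHi]
    omega

theorem clear : WP clear (100 * ((m.A + 1) * (m.n + 1)))
    (fun m' => ∃ y G, m' = { m with y := y, G := G } ∧ m'.Stores 1) m := by
  have hN : 1 ≤ (m.A + 1) * (m.n + 1) := Nat.mul_pos (by omega) (by omega)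
  apply WP.le
  · apply comp
    apply setY
    apply comp
    apply WP.loop (fun m' => ∃ y ≤ (m.A + 1) * (m.n + 1) + 1, ∃ G,
        m' = { m with y := y, G := G } ∧ ∀ k < y, G k = 0)
      (fun m' => (m.A + 1) * (m.n + 1) + 1 - m'.y)
        (M := (m.A + 1) * (m.n + 1) + 1) (hM := by simp)
    case hm => exact ⟨0, Nat.zero_le _, m.G, rfl, by simp⟩
    · rintro _ ⟨y, hy, G, rfl, hG⟩ ht
      simp [tableSize] at ht
      apply comp
      apply storeG
      apply setY
      refine ⟨⟨y + 1, by omega, Function.update G y 0, by simp, fun k hk => ?_⟩, ?_⟩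
      · by_cases h : k = y
        · simp [h]
        -- Cells below y were cleared in earlier rounds.
        · rw [Function.update_of_ne h]
          exact hG k (by omega)
      · simp
        omega
    · rintro _ ⟨y, hy, G, rfl, hG⟩ ht
      simp [tableSize] at ht
      apply storeG
      refine ⟨y, _, rfl, fun k hk => ?_⟩
      replace hk : k ≤ (m.A + 1) * (m.n + 1) := hk
      change Function.update G 1 (((1 : ℕ) : ℝ)) k = _
      unfold shiftedCoeff
      rw [Polynomial.coeff_one]
      -- Entry 1 holds the coefficient of degree 0, because of the leading 0.
      by_cases h1 : k = 1
      · simp [h1]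
      · rw [Function.update_of_ne h1, hG k (by omega)]
        split_ifs <;> first | rfl | omega
  · simp only [tableSize, IExp.cost, RExp.cost, Test.cost]
    generalize (m.A + 1) * (m.n + 1) = N at *
    omega

theorem multiply {P : Polynomial ℝ} (hP : m.Stores P) :
    WP multiply (100 * ((m.A + 1) * (m.n + 1)))
      (fun m' => ∃ y G, m' = { m with y := y, G := G } ∧
        m'.Stores (P * factor (m.a m.j * (m.n + 1)) m.p m.r)) m := by
  have hN : 1 ≤ (m.A + 1) * (m.n + 1) := Nat.mul_pos (by omega) (by omega)
  apply WP.le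
  · apply comp
    apply setY
    -- The index runs downwards: entries above y are already new, while those up to y, the only ones
    -- the recurrence reads, are still old.
    apply WP.loop (fun m' => ∃ y ≤ (m.A + 1) * (m.n + 1), ∃ G,
        m' = { m with y := y, G := G } ∧ ∀ k ≤ (m.A + 1) * (m.n + 1), G k =
          shiftedCoeff (if k ≤ y then P else P * factor (m.a m.j * (m.n + 1)) m.p m.r) k)
      (fun m' => m'.y)
        (M := (m.A + 1) * (m.n + 1)) (hM := le_rfl)
    case hm => exact ⟨_, le_rfl, m.G, rfl, fun k hk => by simpa [hk] using hP k hk⟩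
    · rintro _ ⟨y, hy, G, rfl, hG⟩ ht
      simp at ht
      apply comp
      apply storeG
      apply setY
      refine ⟨⟨y - 1, by omega, _, rfl, fun k hk => ?_⟩, ?_⟩
      · by_cases h : k = y
        · subst h
          rw [if_neg (by omega), shiftedCoeff_mul_factor]
          simp
          rw [hG k hy, hG (k - 1) (by omega), hG (k - _) (by omega), hG (k - _) (by omega)]
          simp
        · simp only [IExp.eval, Mem.state_ivar_y]
          rw [Function.update_of_ne h, hG k hk]
          congr 1
          exact if_congr (by omega) rfl rfl
      · simp
        omega
    · rintro _ ⟨y, hy, G, rfl, hG⟩ ht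
      simp at ht
      refine ⟨y, G, rfl, fun k hk => ?_⟩
      refine (hG k hk).trans ?_
      -- Entry 0 is 0 for every polynomial, so the loop may stop before it.
      by_cases h : k = 0
      · simp [h, shiftedCoeff]
      · rw [if_neg (by omega)]
  · simp only [tableSize, IExp.cost, RExp.cost, Test.cost]
    generalize (m.A + 1) * (m.n + 1) = N at *
    omega

end WP

/-! ### One item on one interval: generating function, integration, slope changes. -/

namespace Program

/-- Compute the product of the factors of all items. -/
def product : Program :=
  .seq (.isetVar 3 (.const 0)) <|
  .loop (.ile (.add (.var 3) (.const 1)) (.var 0)) <|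
    .seq linearize <| .seq multiply <| .isetVar 3 (.add (.var 3) (.const 1))

/-- Integrate the part of weight `w` of the stored polynomial. -/
def integrate : Program :=
  .seq (.rsetVar 7 (.ofIndex (.const 0))) <|
  .seq (.rsetVar 8 (.sub (.var 4) (.var 3))) <|
  .seq (.isetVar 5 (.const 0)) <|
  .loop (.ile (.var 5) (.var 0)) <|
    .seq (.rsetVar 7 (.add (.var 7) (.div
      (.mul (.get 3 (.add (.add (.mul (.var 4) (.add (.var 0) (.const 1))) (.var 5)) (.const 1)))
        (.var 8))
      (.ofIndex (.add (.var 5) (.const 1)))))) <|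
    .seq (.rsetVar 8 (.mul (.var 8) (.sub (.var 4) (.var 3)))) <|
    .isetVar 5 (.add (.var 5) (.const 1))

/-- Add the contribution of the current item on the current interval to the slope changes. -/
def accumulate : Program :=
  .seq (.isetVar 4 (.const 0)) <|
  .loop (.ile (.var 4) (.var 1)) <|
    .seq integrate <|
    .seq (.rsetVar 7 (.div (.mul (.var 7) (.get 2 (.var 2)))
      (.mul (.ofIndex (.get 0 (.var 2))) (.sub (.get 1 (.var 2)) (.get 0 (.var 2)))))) <|
    .seq (.rsetArr 4 (.var 4) (.add (.get 4 (.var 4)) (.var 7))) <|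
    .seq (.rsetArr 4 (.add (.var 4) (.get 0 (.var 2)))
      (.add (.get 4 (.add (.var 4) (.get 0 (.var 2)))) (.sub (.ofIndex (.const 0)) (.var 7)))) <|
    .isetVar 4 (.add (.var 4) (.const 1))

/-- Process the current item on the current interval. -/
def piece : Program :=
  .seq nextBreak <| .seq clear <| .seq product <| .seq accumulate <| .rsetVar 3 (.var 4)

end Program

open Program

namespace WP

variable {Q : Mem → Prop} {m : Mem}

theorem linearize : WP linearize 200
    (fun m' => m' = { m with p := m.intercept m.j, r := m.incline m.j }) m := by
  apply WP.le
  · apply WP.seq (R := fun m' => m' = { m with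
        p := if m.breakHi m.j ≤ m.t then 0
          else if m.breakLo m.j ≤ m.t then
            (m.breakHi m.j - m.t) / (m.breakHi m.j - m.breakLo m.j)
          else 1
        r := if m.breakHi m.j ≤ m.t then 0
          else if m.breakLo m.j ≤ m.t then 0 - 1 / (m.breakHi m.j - m.breakLo m.j)
          else 0 })
    · apply branch
      · intro h
        replace h : m.breakHi m.j ≤ m.t := h
        apply comp
        apply setPReal
        apply setRReal
        simp [h]
      · intro h
        replace h : ¬ m.breakHi m.j ≤ m.t := h
        apply branch
        · intro h'
          replace h' : m.breakLo m.j ≤ m.t := h'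
          apply comp
          apply setPReal
          apply setRReal
          simp [h, h']
          simp [breakHi, breakLo, Mem.breakHi, Mem.breakLo]
        · intro h'
          replace h' : ¬ m.breakLo m.j ≤ m.t := h'
          apply comp
          apply setPReal
          apply setRReal
          simp [h, h']
    · rintro _ rfl
      apply branch
      · intro h
        replace h : m.j ≤ m.i := h
        apply branch
        · intro h'
          replace h' : m.i ≤ m.j := h'
          apply comp
          apply setPReal
          apply setRReal
          simp [Mem.intercept, Mem.incline, le_antisymm h h']
        · intro h'
          replace h' : ¬ m.i ≤ m.j := h'
          apply skip
          have : m.j ≠ m.i := by omega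
          simp [Mem.intercept, Mem.incline, this]
      · intro h
        replace h : ¬ m.j ≤ m.i := h
        apply skip
        have : m.j ≠ m.i := by omega
        simp [Mem.intercept, Mem.incline, this]
  · simp [breakHi, breakLo]

theorem product (hG : m.Stores 1) :
    WP product (400 * (m.n * ((m.A + 1) * (m.n + 1)) + 1))
      (fun m' => ∃ j p r y G, m' = { m with j := j, p := p, r := r, y := y, G := G } ∧
        m'.Stores (∏ k ∈ Finset.range m.n, m.itemFactor k)) m := by
  have hN : 1 ≤ (m.A + 1) * (m.n + 1) := Nat.mul_pos (by omega) (by omega)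
  apply WP.le
  · apply comp
    apply setJ
    apply WP.loop (fun m' => ∃ j ≤ m.n, ∃ p r y G,
        m' = { m with j := j, p := p, r := r, y := y, G := G } ∧
          m'.Stores (∏ k ∈ Finset.range j, m.itemFactor k)) (fun m' => m.n - m'.j)
      (M := m.n) (hM := by simp)
    case hm => exact ⟨0, Nat.zero_le _, m.p, m.r, m.y, m.G, rfl, by
      simp only [Finset.range_zero, Finset.prod_empty]
      exact hG⟩
    swap
    · rintro _ ⟨j, hj, p, r, y, G, rfl, hG⟩ ht
      simp at ht
      obtain rfl : j = m.n := by omega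
      exact ⟨_, _, _, _, _, rfl, hG⟩
    · rintro _ ⟨j, hj, p, r, y, G, rfl, hG⟩ ht
      simp at ht
      apply seq linearize
      rintro _ rfl
      apply seq ((multiply (by exact hG)).le
        (K := 100 * ((m.A + 1) * (m.n + 1))) (by exact le_rfl))
      rintro _ ⟨y', G', rfl, hG'⟩
      apply setJ
      refine ⟨⟨j + 1, by omega, _, _, y', G', rfl, ?_⟩, ?_⟩
      · rw [Finset.prod_range_succ]
        exact hG'
      · simp
        omega
  · simp only [IExp.cost, Test.cost]
    generalize (m.A + 1) * (m.n + 1) = N at *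
    nlinarith

theorem integrate {P : Polynomial ℝ} (hG : m.Stores P) (hw : m.w ≤ m.A) :
    WP integrate (100 * (m.n + 1))
      (fun m' => ∃ e z, m' = { m with e := e, z := z, q := blockIntegral m.n (m.u - m.t) P m.w })
      m := by
  apply WP.le
  · apply comp
    apply setQReal
    apply comp
    apply setZReal
    apply comp
    apply setE
    apply WP.loop (fun m' => ∃ e ≤ m.n + 1,
        m' = { m with
          e := e
          z := (m.u - m.t) ^ (e + 1)
          q := ∑ e ∈ Finset.range e,
            P.coeff (m.w * (m.n + 1) + e) * (m.u - m.t) ^ (e + 1) / (e + 1) })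
      (fun m' => m.n + 1 - m'.e) (M := m.n + 1) (hM := by simp)
    case hm => exact ⟨0, Nat.zero_le _, by simp⟩
    swap
    · rintro _ ⟨e, he, rfl⟩ ht
      simp at ht
      obtain rfl : e = m.n + 1 := by omega
      exact ⟨_, _, rfl⟩
    · rintro _ ⟨e, he, rfl⟩ ht
      simp at ht
      apply comp
      apply setQReal
      apply comp
      apply setZReal
      apply setE
      -- The entry read lies in the table because w ≤ A and e ≤ n.
      have hle : m.w * (m.n + 1) + e + 1 ≤ (m.A + 1) * (m.n + 1) := by nlinarith
      refine ⟨⟨e + 1, by omega, ?_⟩, ?_⟩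
      · simp [Finset.sum_range_succ, hG _ hle, shiftedCoeff, pow_succ]
      · simp
        omega
  · simp only [IExp.cost, RExp.cost, Test.cost]
    omega

theorem accumulate {P : Polynomial ℝ} (hG : m.Stores P) (ha : 0 < m.a m.i)
    (haA : m.a m.i ≤ m.A) :
    WP accumulate (400 * ((m.A + 1) * (m.n + 1)))
      (fun m' => ∃ w e z q D, m' = { m with w := w, e := e, z := z, q := q, D := D } ∧
        ∀ b, hinge (2 * m.A + 1) D b = hinge (2 * m.A + 1) m.D b
          + m.d m.i / (m.hi m.i - m.lo m.i) *
            weightedIntegral m.n m.A (fill b (m.a m.i)) (m.u - m.t) P) m := by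
  apply WP.le
  · apply comp
    apply setW
    apply WP.loop (fun m' => ∃ w ≤ m.A + 1, ∃ e z q D,
        m' = { m with w := w, e := e, z := z, q := q, D := D } ∧
        ∀ b, hinge (2 * m.A + 1) D b = hinge (2 * m.A + 1) m.D b
          + m.d m.i / (m.hi m.i - m.lo m.i) * ∑ w ∈ Finset.range w,
            fill b (m.a m.i) w * blockIntegral m.n (m.u - m.t) P w)
      (fun m' => m.A + 1 - m'.w) (M := m.A + 1) (hM := by simp)
    case hm => exact ⟨0, Nat.zero_le _, m.e, m.z, m.q, m.D, rfl, by simp⟩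
    swap
    · rintro _ ⟨w, hw, e, z, q, D, rfl, hD⟩ ht
      simp at ht
      obtain rfl : w = m.A + 1 := by omega
      exact ⟨_, _, _, _, _, rfl, hD⟩
    · rintro _ ⟨w, hw, e, z, q, D, rfl, hD⟩ ht
      simp at ht
      apply seq ((integrate (P := P) (by exact hG) (by exact ht)).le
        (K := 100 * (m.n + 1)) (by exact le_rfl))
      rintro _ ⟨e', z', rfl⟩
      apply comp
      apply setQReal
      apply comp
      apply storeD
      apply comp
      apply storeD
      apply setW
      refine ⟨⟨w + 1, by omega, _, _, _, _, rfl, fun b => ?_⟩, ?_⟩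
      · simp only [RExp.eval, IExp.eval, Mem.state_rarr_D, Mem.state_ivar_w, Mem.state_rvar_q,
          Mem.state_iarr_a, Mem.state_ivar_i]
        -- The changed knots are w and w + a; both w and a are at most A, which is why 2A + 1 knots
        -- are kept.
        rw [hinge_update (by omega), hinge_update (by omega), hD, Finset.sum_range_succ]
        have ha' : (m.a m.i : ℝ) ≠ 0 := Nat.cast_ne_zero.2 ha.ne'
        have h1 : max (b - w) 0 = max (b - (w + m.a m.i : ℕ)) 0 + m.a m.i * fill b (m.a m.i) w := by
          rw [← max_sub_max_eq_mul_fill b ha w]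
          ring
        rw [h1]
        simp
        field_simp
        ring
      · simp
        omega
  · simp only [IExp.cost, RExp.cost, Test.cost]
    nlinarith

theorem piece (hi : m.i < m.n) (ha : 0 < m.a m.i) (haA : m.a m.i ≤ m.A) (ht : m.t < m.hi m.i) :
    WP piece (2000 * (m.n * ((m.A + 1) * (m.n + 1))))
      (fun m' => ∃ t u j w e y p r q z G D, m' = { m with
          t := t, u := u, j := j, w := w, e := e, y := y, p := p, r := r, q := q, z := z,
          G := G, D := D } ∧
        m.t < t ∧ t ≤ m.hi m.i ∧
        (∃ k < m.n, t = m.breakLo k ∨ t = m.breakHi k) ∧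
        (∀ k < m.n, (m.breakLo k ≤ m.t ∨ t ≤ m.breakLo k) ∧
          (m.breakHi k ≤ m.t ∨ t ≤ m.breakHi k)) ∧
        ∀ b, hinge (2 * m.A + 1) D b = hinge (2 * m.A + 1) m.D b
          + m.d m.i / (m.hi m.i - m.lo m.i) *
            weightedIntegral m.n m.A (fill b (m.a m.i)) (t - m.t)
              (∏ k ∈ Finset.range m.n, m.itemFactor k)) m := by
  have hN : 1 ≤ (m.A + 1) * (m.n + 1) := Nat.mul_pos (by omega) (by omega)
  have hN' : m.n + 1 ≤ (m.A + 1) * (m.n + 1) := Nat.le_mul_of_pos_left _ (by omega)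
  apply WP.le
  · apply seq (nextBreak hi ha.ne' ht)
    rintro _ ⟨u, rfl, h1, h2, h3, h4⟩
    apply seq (clear.le (K := 100 * ((m.A + 1) * (m.n + 1))) (by exact le_rfl))
    rintro _ ⟨y, G, rfl, hG⟩
    apply seq ((product hG).le
      (K := 400 * (m.n * ((m.A + 1) * (m.n + 1)) + 1)) (by exact le_rfl))
    rintro _ ⟨j, p, r, y, G, rfl, hG⟩
    apply seq ((accumulate hG ha haA).le
      (K := 400 * ((m.A + 1) * (m.n + 1))) (by exact le_rfl))
    rintro _ ⟨w, e, z, q, D, rfl, hD⟩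
    apply setTReal
    exact ⟨_, _, _, _, _, _, _, _, _, _, _, _, rfl, h1, h2, h3, h4, hD⟩
  · simp only [RExp.cost]
    generalize (m.A + 1) * (m.n + 1) = N at *
    have : N ≤ m.n * N := Nat.le_mul_of_pos_left _ (by omega)
    omega

end WP

/-! ### From memory contents to the probabilistic quantities of the instance. -/

theorem toArray_val {α : Type} [Zero α] {n : ℕ} (v : Fin n → α) (i : Fin n) :
    toArray v i = v i := by
  simp [toArray]

/-- The memory holds the data of the instance. -/
def Mem.Represents {n : ℕ} (m : Mem) (I : Instance n) : Prop :=
  m.n = n ∧ m.A = I.A ∧ m.a = toArray I.a ∧ m.lo = toArray I.cLo ∧ m.hi = toArray I.cHi ∧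
    m.d = toArray fun i => (I.d i : ℝ)

namespace Mem.Represents

variable {n : ℕ} {m : Mem} {I : Instance n}

theorem breakLo_eq (h : m.Represents I) {i : Fin n} (hi : m.i = i) (j : Fin n) :
    m.breakLo j = I.cLo j * I.a i / I.a j := by
  obtain ⟨-, -, h3, h4, -, -⟩ := h
  simp only [Mem.breakLo, h3, h4, hi, toArray_val]

theorem breakHi_eq (h : m.Represents I) {i : Fin n} (hi : m.i = i) (j : Fin n) :
    m.breakHi j = I.cHi j * I.a i / I.a j := by
  obtain ⟨-, -, h3, -, h5, -⟩ := h
  simp only [Mem.breakHi, h3, h5, hi, toArray_val]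

theorem breakLo_lt_breakHi (h : m.Represents I) {i : Fin n} (hi : m.i = i) (j : Fin n) :
    m.breakLo j < m.breakHi j := by
  rw [h.breakLo_eq hi, h.breakHi_eq hi]
  have h1 : (0 : ℝ) < I.a i := Nat.cast_pos.2 (I.a_pos i)
  have h2 : (0 : ℝ) < I.a j := Nat.cast_pos.2 (I.a_pos j)
  exact div_lt_div_of_pos_right (mul_lt_mul_of_pos_right (I.cLo_lt_cHi j) h1) h2

/-- No break point lies strictly between `m.t` and `t`, so one of the three affine branches of
`tail` is valid throughout; `u` is the offset from `m.t`. -/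
theorem intercept_add_incline (h : m.Represents I) {i : Fin n} (hi : m.i = i) {t : ℝ}
    (j : Fin n) (hj : (m.breakLo j ≤ m.t ∨ t ≤ m.breakLo j) ∧
      (m.breakHi j ≤ m.t ∨ t ≤ m.breakHi j)) {u : ℝ} (hu : u ∈ Set.Icc 0 (t - m.t)) :
    m.intercept j + m.incline j * u = I.precede i (u + m.t) j := by
  have hlt := h.breakLo_lt_breakHi hi j
  have h0 := hu.1
  have h1 := hu.2
  unfold Mem.intercept Mem.incline Instance.precede
  rw [← h.breakLo_eq hi, ← h.breakHi_eq hi]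
  by_cases hji : j = i
  · simp [hji, hi]
  · have hji' : (j : ℕ) ≠ m.i := by
      rw [hi]
      exact fun h => hji (Fin.ext h)
    simp only [hji, hji', if_false]
    split_ifs with h2 h3
    · rw [tail_eq_zero hlt (by linarith)]
      ring
    · have := hj.2.resolve_left h2
      rw [tail_eq_div hlt (by linarith) (by linarith)]
      ring
    · have := hj.1.resolve_left h3
      rw [tail_eq_one hlt (by linarith)]
      ring

theorem weightedIntegral_eq (h : m.Represents I) {i : Fin n} (hi : m.i = i) {t : ℝ}
    (ht : m.t ≤ t) (hbreak : ∀ k < m.n, (m.breakLo k ≤ m.t ∨ t ≤ m.breakLo k) ∧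
      (m.breakHi k ≤ m.t ∨ t ≤ m.breakHi k)) (b : ℝ) :
    weightedIntegral m.n m.A (fill b (m.a m.i)) (t - m.t)
      (∏ k ∈ Finset.range m.n, m.itemFactor k) = ∫ s in m.t..t, I.condShare b i s := by
  obtain ⟨h1, h2, h3, -⟩ := id h
  have hprod : ∏ k ∈ Finset.range m.n, m.itemFactor k
      = ∏ j : Fin n, factor (I.a j * (m.n + 1)) (m.intercept j) (m.incline j) := by
    rw [h1, Finset.prod_range]
    refine Finset.prod_congr rfl fun j _ => ?_
    rw [Mem.itemFactor, h3, toArray_val, h1]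
  rw [hprod, weightedIntegral_prod_factor (by simp [h1]) I.a (by rw [h2, Instance.A])]
  have hshift : ∫ s in m.t..t, I.condShare b i s
      = ∫ u in (0 : ℝ)..(t - m.t), I.condShare b i (u + m.t) := by
    rw [intervalIntegral.integral_comp_add_right]
    simp
  rw [hshift]
  refine intervalIntegral.integral_congr fun u hu => ?_
  rw [Set.uIcc_of_le (by linarith)] at hu
  simp only [Instance.condShare]
  rw [h3, hi, toArray_val]
  congr 1
  funext j
  exact h.intercept_add_incline hi j (hbreak j (by rw [h1]; exact j.2)) hu

end Mem.Represents

/-! ### Summation over intervals and items. -/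

namespace Program

/-- Add the contribution of the current item to the slope changes. -/
def item : Program :=
  .seq (.rsetVar 3 (.get 0 (.var 2))) <|
  .seq (.ite (.rle (.var 3) (.ofIndex (.const 0))) (.rsetVar 3 (.ofIndex (.const 0))) .skip) <|
  .loop (.neg (.rle (.get 1 (.var 2)) (.var 3))) piece

/-- Compute the slope changes of the expected payoff. -/
def items : Program :=
  .seq (.isetVar 2 (.const 0)) <|
  .loop (.ile (.add (.var 2) (.const 1)) (.var 0)) <|
    .seq item <| .isetVar 2 (.add (.var 2) (.const 1))

end Program

open Program

namespace WP

variable {n : ℕ} {I : Instance n} {Q : Mem → Prop} {m : Mem}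

theorem item (h : m.Represents I) {i : Fin n} (hi : m.i = i) :
    WP item (5000 * (m.n * (m.n * ((m.A + 1) * (m.n + 1)))))
      (fun m' => ∃ t u j w e y p r q z G D, m' = { m with
          t := t, u := u, j := j, w := w, e := e, y := y, p := p, r := r, q := q, z := z,
          G := G, D := D } ∧
        ∀ b, hinge (2 * m.A + 1) D b = hinge (2 * m.A + 1) m.D b
          + I.d i * ∫ c, I.share b c i ∂I.law) m := by
  obtain ⟨h1, h2, h3, h4, h5, h6⟩ := id h
  have hN : 1 ≤ (m.A + 1) * (m.n + 1) := Nat.mul_pos (by omega) (by omega)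
  have hin : m.i < m.n := by rw [h1, hi]; exact i.2
  have ha : m.a m.i = I.a i := by rw [h3, hi, toArray_val]
  have hlo : m.lo m.i = I.cLo i := by rw [h4, hi, toArray_val]
  have hhi : m.hi m.i = I.cHi i := by rw [h5, hi, toArray_val]
  have hd : m.d m.i = I.d i := by rw [h6, hi, toArray_val]
  have haA : m.a m.i ≤ m.A := by
    rw [ha, h2, Instance.A]
    exact Finset.single_le_sum (f := I.a) (fun _ _ => Nat.zero_le _) (Finset.mem_univ i)
  apply WP.le
  · apply comp
    apply setTReal
    apply WP.seq (R := fun m' => m' = { m with t := max (I.cLo i) 0 })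
    · apply branch
      · intro ht
        simp [hlo] at ht
        apply setTReal
        simp [ht]
      · intro ht
        simp [hlo] at ht
        apply skip
        simp [ht.le, hlo]
    · rintro _ rfl
      apply WP.loop (fun m' => ∃ t u j w e y p r q z G D, m' = { m with
          t := t, u := u, j := j, w := w, e := e, y := y, p := p, r := r, q := q, z := z,
          G := G, D := D } ∧ max (I.cLo i) 0 ≤ t ∧ t ≤ max (I.cHi i) (max (I.cLo i) 0) ∧
        ∀ b, hinge (2 * m.A + 1) D b = hinge (2 * m.A + 1) m.D b
          + I.d i * ((I.cHi i - I.cLo i)⁻¹ * ∫ s in (max (I.cLo i) 0)..t, I.condShare b i s))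
        -- The measure counts the break points still to the right of t, two for each item.
        (fun m' => ((Finset.range m.n).filter fun k => m'.t < m.breakLo k).card
          + ((Finset.range m.n).filter fun k => m'.t < m.breakHi k).card)
        (M := 2 * m.n) (hM := by
          have h1 := Finset.card_filter_le (Finset.range m.n)
            fun k => max (I.cLo i) 0 < m.breakLo k
          have h2 := Finset.card_filter_le (Finset.range m.n)
            fun k => max (I.cLo i) 0 < m.breakHi k
          rw [Finset.card_range] at h1 h2
          exact (add_le_add h1 h2).trans (by omega))
      case hm =>
        exact ⟨_, _, _, _, _, _, _, _, _, _, _, _, rfl, le_rfl, le_max_right _ _, by simp⟩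
      swap
      · rintro _ ⟨t, u, j, w, e, y, p, r, q, z, G, D, rfl, ht0, ht1, hD⟩ ht
        refine ⟨_, _, _, _, _, _, _, _, _, _, _, _, rfl, fun b => ?_⟩
        replace ht : I.cHi i ≤ t := by
          rw [← hhi]
          simpa using ht
        -- On exit t has reached the upper limit of integration; if that limit equals the lower one,
        -- no round is run.
        rw [hD, I.integral_share, le_antisymm ht1 (max_le ht ht0)]
      · rintro _ ⟨t, u, j, w, e, y, p, r, q, z, G, D, rfl, ht0, ht1, hD⟩ ht
        replace ht : t < m.hi m.i := by simpa using ht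
        apply ((piece (by exact hin) (by rw [ha]; exact I.a_pos i) (by exact haA)
          (by exact ht)).mono (K := 2000 * (m.n * ((m.A + 1) * (m.n + 1)))) (by exact le_rfl))
        rintro _ ⟨t', u, j, w, e, y, p, r, q, z, G, D', rfl, hlt, hle, hex, hbreak, hD'⟩
        replace hlt : t < t' := hlt
        refine ⟨⟨_, _, _, _, _, _, _, _, _, _, _, _, rfl, ht0.trans hlt.le,
          le_max_of_le_left (hle.trans_eq hhi), fun b => ?_⟩, ?_⟩
        · refine (hD' b).trans ?_
          rw [Mem.Represents.weightedIntegral_eq (I := I) (by exact h) (by exact hi) hlt.le hbreak]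
          change hinge (2 * m.A + 1) D b + m.d m.i / (m.hi m.i - m.lo m.i)
            * (∫ s in t..t', I.condShare b i s) = _
          rw [hD, hd, hhi, hlo, ← intervalIntegral.integral_add_adjacent_intervals
            (a := max (I.cLo i) 0) (b := t) (c := t')
            ((I.continuous_condShare b i).intervalIntegrable _ _)
            ((I.continuous_condShare b i).intervalIntegrable _ _)]
          ring
        · have mono : ∀ f : ℕ → ℝ, ((Finset.range m.n).filter fun k => t' < f k)
              ⊆ (Finset.range m.n).filter fun k => t < f k := fun f =>
            Finset.monotone_filter_right _ fun k _ hk => hlt.trans hk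
          -- The new t is itself a break point, which leaves the set of those to the right.
          have strict : ∀ f : ℕ → ℝ, ∀ k < m.n, t' = f k →
              ((Finset.range m.n).filter fun k => t' < f k).card
                < ((Finset.range m.n).filter fun k => t < f k).card := by
            intro f k hk hf
            refine Finset.card_lt_card ((Finset.ssubset_iff_of_subset (mono f)).2 ⟨k, ?_, ?_⟩)
            · simp [hk, ← hf, hlt]
            · simp [hf]
          obtain ⟨k, hk, hk' | hk'⟩ := hex
          · exact add_lt_add_of_lt_of_le (strict m.breakLo k hk hk')
              (Finset.card_le_card (mono m.breakHi))
          · exact add_lt_add_of_le_of_lt (Finset.card_le_card (mono m.breakLo))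
              (strict m.breakHi k hk hk')
  · simp only [IExp.cost, RExp.cost, Test.cost]
    generalize (m.A + 1) * (m.n + 1) = N at *
    have h1 : 1 ≤ m.n := by omega
    have h2 : m.n ≤ m.n * N := Nat.le_mul_of_pos_right _ hN
    have h3 : m.n * N ≤ m.n * (m.n * N) := Nat.le_mul_of_pos_left _ h1
    have h4 : 2 * m.n * (2000 * (m.n * N) + (1 + 1 + 1 + 1 + 1))
        = 4000 * (m.n * (m.n * N)) + 10 * m.n := by ring
    have h5 : m.n * N + m.n ≤ m.n * (m.n * N) + m.n * (m.n * N) := by omega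
    nlinarith

theorem items (h : m.Represents I) :
    WP items (6000 * (m.n * (m.n * (m.n * ((m.A + 1) * (m.n + 1)))) + 1))
      (fun m' => ∃ i t u j w e y p r q z G D, m' = { m with
          i := i, t := t, u := u, j := j, w := w, e := e, y := y, p := p, r := r, q := q,
          z := z, G := G, D := D } ∧
        ∀ b, hinge (2 * m.A + 1) D b = hinge (2 * m.A + 1) m.D b
          + ∑ i, I.d i * ∫ c, I.share b c i ∂I.law) m := by
  have hN : 1 ≤ (m.A + 1) * (m.n + 1) := Nat.mul_pos (by omega) (by omega)
  have hn : m.n = n := h.1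
  -- The summand extended by 0, so that partial sums can run over natural numbers.
  let g : ℝ → ℕ → ℝ := fun b k =>
    if hk : k < n then I.d ⟨k, hk⟩ * ∫ c, I.share b c ⟨k, hk⟩ ∂I.law else 0
  apply WP.le
  · apply comp
    apply setI
    apply WP.loop (fun m' => ∃ i ≤ m.n, ∃ t u j w e y p r q z G D, m' = { m with
          i := i, t := t, u := u, j := j, w := w, e := e, y := y, p := p, r := r, q := q,
          z := z, G := G, D := D } ∧
        ∀ b, hinge (2 * m.A + 1) D b = hinge (2 * m.A + 1) m.D b
          + ∑ k ∈ Finset.range i, g b k)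
      (fun m' => m.n - m'.i) (M := m.n) (hM := by simp)
    case hm =>
      exact ⟨0, Nat.zero_le _, _, _, _, _, _, _, _, _, _, _, _, _, rfl, by simp⟩
    swap
    · rintro _ ⟨i, hi, t, u, j, w, e, y, p, r, q, z, G, D, rfl, hD⟩ ht
      simp at ht
      obtain rfl : i = n := by omega
      refine ⟨_, _, _, _, _, _, _, _, _, _, _, _, _, rfl, fun b => ?_⟩
      rw [hD, Finset.sum_range]
      simp [g]
    · rintro _ ⟨i, hi, t, u, j, w, e, y, p, r, q, z, G, D, rfl, hD⟩ ht
      simp at ht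
      have hin : i < n := by omega
      apply seq ((item (I := I) (by exact h) (i := ⟨i, hin⟩) (by rfl)).le
        (K := 5000 * (m.n * (m.n * ((m.A + 1) * (m.n + 1))))) (by exact le_rfl))
      rintro _ ⟨t, u, j, w, e, y, p, r, q, z, G, D', rfl, hD'⟩
      apply setI
      refine ⟨⟨i + 1, by omega, _, _, _, _, _, _, _, _, _, _, _, _, rfl, fun b => ?_⟩, ?_⟩
      · refine (hD' b).trans ?_
        rw [Finset.sum_range_succ, ← add_assoc, ← hD b]
        simp [g, hin]
      · simp
        omega
  · simp only [IExp.cost, Test.cost]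
    generalize (m.A + 1) * (m.n + 1) = N at *
    rcases Nat.eq_zero_or_pos m.n with h0 | h0
    · rw [h0]
      omega
    · have h2 : 1 ≤ m.n * (m.n * N) := Nat.mul_pos h0 (Nat.mul_pos h0 hN)
      nlinarith

end WP

/-! ### Maximization of the piecewise linear objective. -/

theorem hinge_eq_of_mem_Icc {M w : ℕ} (hw : w + 1 ≤ M) (D : ℕ → ℝ) {b : ℝ}
    (hb : b ∈ Set.Icc (w : ℝ) (w + 1)) :
    hinge M D b = (∑ k ∈ Finset.range w, D k * (w - k))
      + (∑ k ∈ Finset.range (w + 1), D k) * (b - w) := by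
  have h1 : hinge M D b = ∑ k ∈ Finset.range (w + 1), D k * (b - k) := by
    unfold hinge
    rw [← Finset.sum_subset (Finset.range_subset_range.2 hw)]
    · refine Finset.sum_congr rfl fun k hk => ?_
      have : (k : ℝ) ≤ w := Nat.cast_le.2 (Nat.lt_succ_iff.1 (Finset.mem_range.1 hk))
      rw [max_eq_left (by linarith [hb.1])]
    · intro k _ hk
      have : ((w + 1 : ℕ) : ℝ) ≤ k := Nat.cast_le.2 (by simpa using hk)
      push_cast at this
      rw [max_eq_right (by linarith [hb.2]), mul_zero]
  -- The knot w changes the slope to its right but adds nothing to the value at w.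
  have h2 : ∑ k ∈ Finset.range w, D k * ((w : ℝ) - k)
      = ∑ k ∈ Finset.range (w + 1), D k * ((w : ℝ) - k) := by
    simp [Finset.sum_range_succ]
  rw [h1, h2, Finset.sum_mul, ← Finset.sum_add_distrib]
  refine Finset.sum_congr rfl fun k _ => ?_
  ring

namespace Program

/-- Extend the maximization of the expected payoff to the capacities up to `ivar 4 + 1`. -/
def extend : Program :=
  .seq (.ite (.rle (.ofIndex (.var 4)) (.var 1))
    (.seq (.rsetVar 12 (.var 1)) <|
      .rsetVar 11 (.add (.var 9) (.mul (.var 10) (.sub (.var 1) (.ofIndex (.var 4))))))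
    .skip) <|
  .ite (.rle (.ofIndex (.var 4)) (.var 2))
    (.seq (.ite (.rle (.var 2) (.add (.ofIndex (.var 4)) (.ofIndex (.const 1))))
      (.rsetVar 13 (.var 2)) (.rsetVar 13 (.add (.ofIndex (.var 4)) (.ofIndex (.const 1))))) <|
    .ite (.rle (.var 1) (.var 13))
      (.seq (.rsetVar 7 (.add (.var 9) (.mul (.var 10) (.sub (.var 13) (.ofIndex (.var 4)))))) <|
        .ite (.rle (.var 7) (.var 11)) .skip (.seq (.rsetVar 11 (.var 7)) (.rsetVar 12 (.var 13))))
      .skip)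
    .skip

/-- Maximize the expected payoff. -/
def maximize : Program :=
  .seq (.isetVar 4 (.const 0)) <|
  .seq (.rsetVar 9 (.ofIndex (.const 0))) <|
  .seq (.rsetVar 10 (.sub (.ofIndex (.const 0)) (.var 0))) <|
  .seq (.rsetVar 12 (.var 1)) <|
  .seq (.loop (.ile (.add (.var 4) (.const 1)) (.var 1)) <|
    .seq (.rsetVar 10 (.add (.var 10) (.get 4 (.var 4)))) <|
    .seq extend <|
    .seq (.rsetVar 9 (.add (.var 9) (.var 10))) <|
    .isetVar 4 (.add (.var 4) (.const 1))) <|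
  .seq (.rsetVar 0 (.var 12)) <| .rsetVar 1 (.var 11)

/-- Solve the stochastic bilevel continuous knapsack problem. -/
def solve : Program := .seq totalSize <| .seq items maximize

end Program

open Program

namespace WP

variable {Q : Mem → Prop} {m : Mem}

/-- On a unit interval f is affine, so only the ends of its intersection with `[bLo, bHi]` matter.
As long as `bLo` lies beyond w + 1 nothing is claimed about `best`; it is set anew at `bLo` in each
such round. -/
theorem extend {f : ℝ → ℝ} (hbLo : m.bLo ≤ m.bHi)
    (hf : ∀ b ∈ Set.Icc (m.w : ℝ) (m.w + 1), f b = m.val + m.slope * (b - m.w))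
    (harg : m.arg ∈ Set.Icc m.bLo m.bHi)
    (hbest : m.bLo < m.w → m.best = f m.arg ∧
      ∀ b ∈ Set.Icc m.bLo m.bHi, b ≤ m.w → f b ≤ m.best) :
    WP extend 100
      (fun m' => ∃ arg best cand q,
        m' = { m with arg := arg, best := best, cand := cand, q := q } ∧
        arg ∈ Set.Icc m.bLo m.bHi ∧
        (m.bLo ≤ m.w + 1 → best = f arg ∧
          ∀ b ∈ Set.Icc m.bLo m.bHi, b ≤ m.w + 1 → f b ≤ best)) m := by
  apply WP.le
  · apply WP.seq (R := fun m' => ∃ arg best, m' = { m with arg := arg, best := best } ∧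
        arg ∈ Set.Icc m.bLo m.bHi ∧
        (m.bLo ≤ m.w + 1 → best = f arg ∧
          ∀ b ∈ Set.Icc m.bLo m.bHi, b ≤ m.w ∨ b = m.bLo → f b ≤ best))
    · apply branch
      · intro h
        replace h : (m.w : ℝ) ≤ m.bLo := h
        apply comp
        apply setArg
        apply setBest
        refine ⟨_, _, rfl, ⟨le_rfl, hbLo⟩, fun h' => ?_⟩
        have heq := hf m.bLo ⟨h, h'⟩
        refine ⟨heq.symm, fun b hb hb' => ?_⟩
        have : b = m.bLo := by
          rcases hb' with hb' | hb'
          · linarith [hb.1]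
          · exact hb'
        rw [this]
        exact heq.le
      · intro h
        replace h : ¬ (m.w : ℝ) ≤ m.bLo := h
        obtain ⟨h1, h2⟩ := hbest (not_le.1 h)
        apply skip
        refine ⟨_, _, rfl, harg, fun _ => ⟨h1, fun b hb hb' => h2 b hb ?_⟩⟩
        rcases hb' with hb' | hb'
        · exact hb'
        · linarith
    · rintro _ ⟨arg, best, rfl, harg', hbest'⟩
      apply branch
      · intro h
        replace h : (m.w : ℝ) ≤ m.bHi := h
        apply WP.seq (R := fun m' => m' = { m with
          arg := arg, best := best, cand := min m.bHi (m.w + 1) })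
        · apply branch
          · intro h'
            simp at h'
            apply setCand
            simp [h']
          · intro h'
            simp at h'
            apply setCand
            simp [h'.le]
        · rintro _ rfl
          have hcw : (m.w : ℝ) ≤ min m.bHi (m.w + 1) := le_min h (by linarith)
          have hcw' := min_le_right m.bHi ((m.w : ℝ) + 1)
          have hcH := min_le_left m.bHi ((m.w : ℝ) + 1)
          have hfc := hf _ ⟨hcw, hcw'⟩
          apply branch
          · intro hc
            replace hc : m.bLo ≤ min m.bHi (m.w + 1) := hc
            obtain ⟨hb1, hb2⟩ := hbest' (hc.trans hcw')
            -- For nonnegative slope f is bounded by its value at the candidate, otherwise by its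
            -- value at the larger of w and `bLo`, which `best` already dominates.
            have key : ∀ v, best ≤ v → f (min m.bHi (m.w + 1)) ≤ v →
                ∀ b ∈ Set.Icc m.bLo m.bHi, b ≤ m.w + 1 → f b ≤ v := by
              intro v hv1 hv2 b hb hbw
              rcases le_total b m.w with hle | hle
              · exact (hb2 b hb (.inl hle)).trans hv1
              · have hbc : b ≤ min m.bHi (m.w + 1) := le_min hb.2 hbw
                have hfb := hf b ⟨hle, hbw⟩
                rcases le_total 0 m.slope with hs | hs
                · nlinarith
                · rcases le_total m.bLo m.w with hl | hl
                  · have h1 := hf m.w ⟨le_rfl, by linarith⟩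
                    have h2 := hb2 m.w ⟨hl, h⟩ (.inl le_rfl)
                    nlinarith
                  · have h1 := hf m.bLo ⟨hl, hc.trans hcw'⟩
                    have h2 := hb2 m.bLo ⟨le_rfl, hbLo⟩ (.inr rfl)
                    nlinarith [hb.1]
            apply comp
            apply setQReal
            apply branch
            · intro hq
              replace hq : m.val + m.slope * (min m.bHi (m.w + 1) - m.w) ≤ best := hq
              apply skip
              exact ⟨_, _, _, _, rfl, harg', fun _ => ⟨hb1, key best le_rfl (hfc.trans_le hq)⟩⟩
            · intro hq
              replace hq : ¬ m.val + m.slope * (min m.bHi (m.w + 1) - m.w) ≤ best := hq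
              apply comp
              apply setBest
              apply setArg
              exact ⟨_, _, _, _, rfl, ⟨hc, hcH⟩, fun _ =>
                ⟨hfc.symm, key _ (not_le.1 hq).le hfc.le⟩⟩
          · intro hc
            replace hc : ¬ m.bLo ≤ min m.bHi (m.w + 1) := hc
            apply skip
            refine ⟨_, _, _, _, rfl, harg', fun h' => absurd (le_min hbLo h') hc⟩
      · intro h
        replace h : ¬ (m.w : ℝ) ≤ m.bHi := h
        apply skip
        refine ⟨_, _, _, _, rfl, harg', fun h' => ⟨(hbest' h').1, fun b hb _ => ?_⟩⟩
        exact (hbest' h').2 b hb (.inl (by linarith [hb.2]))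
  · simp

theorem maximize (h0 : 0 ≤ m.bLo) (hbLo : m.bLo ≤ m.bHi) (hbHi : m.bHi ≤ m.A) (hA : 1 ≤ m.A) :
    WP maximize (200 * (m.A + 1))
      (fun m' => m'.δ ∈ Set.Icc m.bLo m.bHi ∧
        m'.bLo = hinge (2 * m.A + 1) m.D m'.δ - m.δ * m'.δ ∧
        ∀ b ∈ Set.Icc m.bLo m.bHi, hinge (2 * m.A + 1) m.D b - m.δ * b ≤ m'.bLo) m := by
  apply WP.le
  · apply comp
    apply setW
    apply comp
    apply setVal
    apply comp
    apply setSlope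
    apply comp
    apply setArg
    apply WP.seq (R := fun m' => ∃ w arg best cand q val slope, m' = { m with
        w := w, arg := arg, best := best, cand := cand, q := q, val := val, slope := slope } ∧
        arg ∈ Set.Icc m.bLo m.bHi ∧ best = hinge (2 * m.A + 1) m.D arg - m.δ * arg ∧
        ∀ b ∈ Set.Icc m.bLo m.bHi, hinge (2 * m.A + 1) m.D b - m.δ * b ≤ best)
    · apply WP.loop (fun m' => ∃ w ≤ m.A, ∃ arg best cand q, m' = { m with
          w := w
          arg := arg
          best := best
          cand := cand
          q := q
          val := ∑ k ∈ Finset.range w, m.D k * (w - k) - m.δ * w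
          slope := ∑ k ∈ Finset.range w, m.D k - m.δ } ∧
          arg ∈ Set.Icc m.bLo m.bHi ∧
          -- At w = 0 `best` is not yet initialized, even if `bLo = 0`; since A ≥ 1, the first round
          -- takes place.
          (1 ≤ w → m.bLo ≤ w → best = hinge (2 * m.A + 1) m.D arg - m.δ * arg ∧
            ∀ b ∈ Set.Icc m.bLo m.bHi, b ≤ w →
              hinge (2 * m.A + 1) m.D b - m.δ * b ≤ best))
        (fun m' => m.A - m'.w) (M := m.A) (hM := by simp)
      case hm =>
        exact ⟨0, Nat.zero_le _, m.bLo, m.best, m.cand, m.q, by simp, ⟨le_rfl, hbLo⟩, by simp⟩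
      swap
      · rintro _ ⟨w, hw, arg, best, cand, q, rfl, harg, hbest⟩ ht
        simp at ht
        obtain rfl : w = m.A := by omega
        obtain ⟨h1, h2⟩ := hbest hA (hbLo.trans hbHi)
        exact ⟨_, _, _, _, _, _, _, rfl, harg, h1, fun b hb => h2 b hb (hb.2.trans hbHi)⟩
      · rintro _ ⟨w, hw, arg, best, cand, q, rfl, harg, hbest⟩ ht
        simp at ht
        apply comp
        -- With the change at knot w added, the slope is the one on `[w, w + 1]`.
        apply setSlope
        apply seq (extend (f := fun b => hinge (2 * m.A + 1) m.D b - m.δ * b) (by exact hbLo)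
          (by
            intro b hb
            replace hb : b ∈ Set.Icc (w : ℝ) (w + 1) := hb
            dsimp only
            rw [hinge_eq_of_mem_Icc (by omega) m.D hb]
            simp [Finset.sum_range_succ]
            ring)
          (by exact harg)
          (by
            intro h
            replace h : m.bLo < w := h
            refine hbest ?_ h.le
            exact Nat.cast_pos.1 (h0.trans_lt h)))
        rintro _ ⟨arg, best, cand, q, rfl, harg', hbest'⟩
        apply comp
        apply setVal
        apply setW
        refine ⟨⟨w + 1, by omega, arg, best, cand, q, ?_, harg', fun _ h => ?_⟩, ?_⟩
        · simp [Finset.sum_range_succ]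
          have h1 : ∑ k ∈ Finset.range w, m.D k * ((w : ℝ) + 1 - k)
              = ∑ k ∈ Finset.range w, m.D k * ((w : ℝ) - k) + ∑ k ∈ Finset.range w, m.D k := by
            rw [← Finset.sum_add_distrib]
            refine Finset.sum_congr rfl fun k _ => ?_
            ring
          rw [h1]
          constructor <;> ring
        · push_cast at h ⊢
          exact hbest' h
        · simp
          omega
    · rintro _ ⟨w, arg, best, cand, q, val, slope, rfl, h1, h2, h3⟩
      apply comp
      apply setDelta
      apply setBLo
      exact ⟨h1, h2, h3⟩
  · simp only [IExp.cost, RExp.cost, Test.cost]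
    omega

end WP

/-! ### The whole program and its running time. -/

/-- The input as a named memory. -/
noncomputable def Instance.mem {n : ℕ} (I : Instance n) : Mem where
  n := n
  A := 0
  i := 0
  j := 0
  w := 0
  e := 0
  y := 0
  δ := I.δ
  bLo := I.bLo
  bHi := I.bHi
  t := 0
  u := 0
  p := 0
  r := 0
  q := 0
  z := 0
  val := 0
  slope := 0
  best := 0
  arg := 0
  cand := 0
  a := toArray I.a
  lo := toArray I.cLo
  hi := toArray I.cHi
  d := toArray fun i => (I.d i : ℝ)
  G := 0
  D := 0

theorem Instance.state_mem {n : ℕ} (I : Instance n) : I.mem.state = I.input := by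
  simp only [Mem.state, Instance.mem, Instance.input, State.mk.injEq]
  refine ⟨?_, ?_, ?_, ?_⟩ <;> funext k
  · rcases k with _ | _ | _ | _ | _ | _ | _ | k <;> rfl
  · rcases k with _ | _ | _ | _ | _ | _ | _ | _ | _ | _ | _ | _ | _ | _ | k <;> simp
  · rcases k with _ | k <;> rfl
  · rcases k with _ | _ | _ | _ | _ | k <;> rfl

theorem WP.solve {n : ℕ} (hn : 1 ≤ n) (I : Instance n) :
    WP solve (50000 * (n ^ 4 * I.A)) (fun m => I.IsSolution m.δ m.bLo) I.mem := by
  have hA : n ≤ I.A := by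
    have := Finset.card_nsmul_le_sum Finset.univ I.a 1 fun i _ => I.a_pos i
    simpa [Instance.A] using this
  have hsum : ∑ k ∈ Finset.range n, toArray I.a k = I.A := by
    rw [Finset.sum_range, Instance.A]
    simp only [toArray_val]
  apply WP.le
  · apply seq (WP.totalSize (m := I.mem))
    rintro _ rfl
    apply seq ((WP.items (I := I) ⟨rfl, hsum, rfl, rfl, rfl, rfl⟩).le
      (K := 6000 * (n * (n * (n * ((I.A + 1) * (n + 1)))) + 1)) (by rw [← hsum]; exact le_rfl))
    rintro _ ⟨i, t, u, j, w, e, y, p, r, q, z, G, D, rfl, hD⟩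
    apply ((WP.maximize (by exact I.bLo_nonneg) (by exact I.bLo_le_bHi)
      (by
        refine I.bHi_le.trans_eq ?_
        exact congrArg _ hsum.symm)
      (by
        refine (hn.trans hA).trans_eq ?_
        exact hsum.symm)).mono (K := 200 * (I.A + 1)) (by rw [← hsum]; exact le_rfl))
    rintro m' ⟨h1, h2, h3⟩
    -- The array of slope changes starts at 0, so in the end it encodes exactly the leader's
    -- expected revenue.
    have hval : ∀ b, hinge (2 * (∑ k ∈ Finset.range n, toArray I.a k) + 1) D b - I.δ * b
        = I.value b := by
      intro b
      refine (congrArg (· - I.δ * b) (hD b)).trans ?_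
      simp [Instance.value, hinge, Instance.mem]
    refine I.isSolution_of_value h1 ?_ fun b hb => ?_
    · rw [← hval]
      exact h2.symm
    · rw [← hval]
      exact h3 b hb
  -- Since 1 ≤ n ≤ A, the bounds A + 1 ≤ 2A and n + 1 ≤ 2n turn the dominant term into a multiple of
  -- n^4 A.
  · have h1 : n ^ 3 * ((I.A + 1) * (n + 1)) ≤ n ^ 3 * ((2 * I.A) * (2 * n)) :=
      Nat.mul_le_mul_left _ (Nat.mul_le_mul (by omega) (by omega))
    have h2 : n * (n * (n * ((I.A + 1) * (n + 1)))) = n ^ 3 * ((I.A + 1) * (n + 1)) := by ring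
    have h3 : n ^ 3 * ((2 * I.A) * (2 * n)) = 4 * (n ^ 4 * I.A) := by ring
    have h4 : I.A ≤ n ^ 4 * I.A := Nat.le_mul_of_pos_left _ (Nat.pow_pos hn)
    rw [h2]
    change 20 * (n + 1) + _ ≤ _
    omega

end BilevelKnapsack

/-- One program solves every instance with `n ≥ 1` items and total size `A` in `O(n⁴ A)` steps;
it returns an optimal capacity and the optimal value in the real variables `0` and `1`. -/
theorem mainTheorem4 :
    ∃ (p : BilevelKnapsack.Program) (C : ℕ),
      ∀ (n : ℕ), 1 ≤ n → ∀ I : BilevelKnapsack.Instance n,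
        ∃ (s : BilevelKnapsack.State) (k : ℕ),
          BilevelKnapsack.Exec p I.input s k ∧
          k ≤ C * (n ^ 4 * I.A) ∧
          I.IsSolution (s.rvar 0) (s.rvar 1) := by
  refine ⟨BilevelKnapsack.Program.solve, 50000, fun n hn I => ?_⟩
  obtain ⟨m, k, he, hk, hm⟩ := BilevelKnapsack.WP.solve hn I
  exact ⟨m.state, k, I.state_mem ▸ he, hk, hm⟩
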